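/- Let $n,k$ be positive integers with $k<n/2$, and let $K_n^{\le k}$ be the hypergraph with vertex set $[n]=\{1,\dots,n\}$ whose edges are all non-empty subsets of $[n]$ of size at most $k$. A $1$-factor of a hypergraph is a spanning sub-hypergraph in which every vertex is contained in exactly one edge, and a hypergraph is $1$-factorable if its edge set can be partitioned into (the edge sets of) $1$-factors. Then $K_n^{\le k}$ is $1$-factorable if and only if one of the following two conditions holds: (i) $n\equiv 0 \pmod k$ and $n\ge k(k-2)$; (ii) $n\equiv -1 \pmod k$ and $n\ge k\left(\lceil k/2\rceil-1\right)-1$. -/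

import Mathlib

/-- `F` is an `ℓ`-factor of `H`: a sub-hypergraph of `H` with the same vertex set in which every
vertex is contained in exactly `ℓ` edges. -/
def IsHypergraphFactor {α : Type*} (ℓ : ℕ) (H F : Hypergraph α) : Prop :=
  F.vertexSet = H.vertexSet ∧ F.edgeSet ⊆ H.edgeSet ∧
    ∀ v ∈ H.vertexSet, {e | e ∈ F.edgeSet ∧ v ∈ e}.encard = ℓ

/-- `H` is `ℓ`-factorable: there is a family of `ℓ`-factors of `H` whose edge sets partition the
edge set of `H`, i.e. every edge of `H` is an edge of exactly one factor of the family. -/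
def IsHypergraphFactorable {α : Type*} (ℓ : ℕ) (H : Hypergraph α) : Prop :=
  ∃ 𝓕 : Set (Hypergraph α), (∀ F ∈ 𝓕, IsHypergraphFactor ℓ H F) ∧
    ∀ e ∈ H.edgeSet, ∃! F, F ∈ 𝓕 ∧ e ∈ F.edgeSet

/-- The hypergraph `K_n^{≤ k}`, with `[n]` modelled by `Fin n`: its edges are all non-empty
subsets of the vertex set of size at most `k`. -/
def completeHypergraphLE (n k : ℕ) : Hypergraph (Fin n) where
  vertexSet := Set.univ
  edgeSet := {e | e.Nonempty ∧ e.ncard ≤ k}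
  subset_vertexSet_of_mem_edgeSet' := fun _ _ => Set.subset_univ _

/-! Write n = m + 1. By Baranyai's theorem for several edge sizes, only sizes matter: a
1-factorization exists iff each factor can be given a number of edges of each size so that the sizes
in every factor add up to n and each size i ≤ k is used C(n, i) times in all
(`IsFactorDistribution`). The number of factors is then the degree of a vertex, `chooseSum m k`.

Necessity. If r = n mod k is not 0, every factor has two edges of size below k, or one of size r;
counting gives C(m, k-1) < C(n, r), which for k < n/2 forces r = k - 1. If n = Qk or n = Qk - 1, a
factor with only Q edges uses at least Q, respectively Q - 1, edges of size k. Summing over the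
factors bounds Q - 1 times the number of subsets of [m] of size below s strictly by C(m, s), with s
= k - 1, respectively s = k - 2. If n is below the claimed bound, the last three terms of that sum
already contradict this.

Sufficiency. Record an edge of size below k by its deficit, k minus its size. The total deficit of a
factor is fixed modulo k. Some factors get the least one, 0 or 1, and have Q edges; the others are
bins with k more and Q + 1 edges. A bin is seeded with large deficits and filled up with deficits 1
(if k divides n) or 2 (if k divides n + 1). The number of fillers comes out right because the total
deficit does; the real constraint is that no bin exceeds Q + 1 edges. -/

/-! ### Baranyai's theorem for several edge sizes -/

/-- Integral rounding of a bipartite fractional assignment. If item `j` has `N j x` copies of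
fractional weight `w x / M` at `x`, these weights add up to `1` for each `j` and to the natural
number `t x` for each `x`, then every `j` can be assigned one of its `x` so that `x` is used
exactly `t x` times. -/
theorem exists_assignment_of_fractional {J κ : Type*} [Fintype J] [Fintype κ] [DecidableEq κ]
    (N : J → κ → ℕ) (w t : κ → ℕ) (M : ℕ) (hM : 0 < M)
    (h1 : ∀ j, ∑ x, N j x * w x = M) (h2 : ∀ x, (∑ j, N j x) * w x = M * t x) :
    ∃ f : J → κ, (∀ j, 0 < N j (f j)) ∧
      ∀ x, (Finset.univ.filter fun j => f j = x).card = t x := by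
  classical
  let nb : J → Finset (Σ x, Fin (t x)) := fun j =>
    (Finset.univ.filter fun x => 0 < N j x).sigma fun _ => Finset.univ
  -- Hall's condition for `t x` copies of each x: the items of X carry weight |X|, all of it on
  -- their neighbours, which can hold at most the sum of their `t x`.
  have hall : ∀ X : Finset J, X.card ≤ (X.biUnion nb).card := by
    intro X
    have hb : X.biUnion nb =
        (Finset.univ.filter fun x => ∃ j ∈ X, 0 < N j x).sigma fun _ => Finset.univ := by
      ext ⟨x, i⟩
      simp [nb]
    rw [hb, Finset.card_sigma]
    refine Nat.le_of_mul_le_mul_left ?_ hM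
    calc M * X.card = ∑ j ∈ X, ∑ x, N j x * w x := by simp [h1, mul_comm]
      _ = ∑ x, (∑ j ∈ X, N j x) * w x := by
        rw [Finset.sum_comm]; simp [Finset.sum_mul]
      _ = ∑ x with ∃ j ∈ X, 0 < N j x, (∑ j ∈ X, N j x) * w x := by
        rw [Finset.sum_filter]
        refine Finset.sum_congr rfl fun x _ => ?_
        split_ifs with h
        · rfl
        · push Not at h
          rw [Finset.sum_eq_zero fun j hj => Nat.le_zero.mp (h j hj), zero_mul]
      _ ≤ ∑ x with ∃ j ∈ X, 0 < N j x, M * t x := by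
        refine Finset.sum_le_sum fun x _ => ?_
        rw [← h2 x]
        exact Nat.mul_le_mul_right _ (Finset.sum_le_sum_of_subset (Finset.subset_univ X))
      _ = M * ∑ x with ∃ j ∈ X, 0 < N j x, (Finset.univ : Finset (Fin (t x))).card := by
        simp [Finset.mul_sum]
  obtain ⟨F, hFi, hF⟩ := (Finset.all_card_le_biUnion_card_iff_exists_injective nb).mp hall
  -- Equal cardinalities make the matching a bijection, so every copy is used and x is chosen
  -- exactly `t x` times.
  have hcard : Fintype.card J = Fintype.card (Σ x, Fin (t x)) := by
    refine Nat.eq_of_mul_eq_mul_left hM ?_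
    calc M * Fintype.card J = ∑ j, ∑ x, N j x * w x := by simp [h1, mul_comm]
      _ = ∑ x, (∑ j, N j x) * w x := by
        rw [Finset.sum_comm]; simp [Finset.sum_mul]
      _ = M * Fintype.card (Σ x, Fin (t x)) := by
        simp [h2, Finset.mul_sum]
  have hbij := (Fintype.bijective_iff_injective_and_card F).mpr ⟨hFi, hcard⟩
  refine ⟨fun j => (F j).1, fun j => ?_, fun x => ?_⟩
  · have := hF j
    simp only [nb, Finset.mem_sigma, Finset.mem_filter] at this
    exact this.1.2
  · have : (Finset.univ.filter fun y : (Σ x, Fin (t x)) => y.1 = x).card = t x := by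
      have : (Finset.univ.filter fun y : (Σ x, Fin (t x)) => y.1 = x) =
          Finset.sigma {x} fun _ => Finset.univ := by
        ext ⟨y, i⟩; simp
      rw [this, Finset.card_sigma]; simp
    rw [← this]
    refine Finset.card_bij (fun j _ => F j) ?_ (fun _ _ _ _ h => hFi h) ?_
    · intro j hj; simpa using hj
    · intro y hy
      obtain ⟨j, rfl⟩ := hbij.2 y
      exact ⟨j, by simpa using hy, rfl⟩

/-- A stage of the vertex-by-vertex construction of a factorization: the vertices of `W` have
been distributed. `N j (i, S)` is the number of edges of the factor `j` with label `i`
(and final size `r i`) whose current set of vertices is `S`. -/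
structure IsPartialFactorization {α J ι : Type*} [Fintype α] [DecidableEq α] [Fintype J]
    [Fintype ι] (r : ι → ℕ) (W : Finset α) (N : J → ι × Finset α → ℕ) : Prop where
  sum_missing : ∀ j, ∑ x, N j x * (r x.1 - x.2.card) + W.card = Fintype.card α
  sum_factors : ∀ x, ∑ j, N j x =
    if x.2 ⊆ W ∧ x.2.card ≤ r x.1
      then (Fintype.card α - W.card).choose (r x.1 - x.2.card) else 0
  sum_incident : ∀ j, ∀ v ∈ W, ∑ x, N j x * (if v ∈ x.2 then 1 else 0) = 1

/-- Each factor must put v into exactly one of its partial edges. Choosing an edge with probability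
(missing vertices) / (vertices not yet distributed) preserves all counts on average, and the
rounding lemma makes the choice integral. -/
theorem IsPartialFactorization.exists_insert {α J ι : Type*} [Fintype α] [DecidableEq α]
    [Fintype J] [Fintype ι] {r : ι → ℕ} {W : Finset α} {N : J → ι × Finset α → ℕ}
    (h : IsPartialFactorization r W N) {v : α} (hv : v ∉ W) :
    ∃ N' : J → ι × Finset α → ℕ, IsPartialFactorization r (insert v W) N' := by
  classical
  have hcard : (insert v W).card = W.card + 1 := Finset.card_insert_of_notMem hv
  have hle : (insert v W).card ≤ Fintype.card α := Finset.card_le_univ _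
  obtain ⟨m, hm⟩ : ∃ m, Fintype.card α = W.card + 1 + m := Nat.exists_eq_add_of_le (by omega)
  have hm1 : Fintype.card α - W.card = m + 1 := by omega
  have hm2 : Fintype.card α - (insert v W).card = m := by omega
  have hf := h.sum_factors
  rw [hm1] at hf
  -- The number of extensions of S to a set of size `r i` that contain v, hence the number of copies
  -- of (i, S) that must receive v.
  let t : ι × Finset α → ℕ := fun x =>
    if x.2 ⊆ W ∧ x.2.card < r x.1 then m.choose (r x.1 - x.2.card - 1) else 0
  obtain ⟨f, hfN, hft⟩ := exists_assignment_of_fractional N (fun x => r x.1 - x.2.card) t (m + 1)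
    (by omega) (fun j => by have := h.sum_missing j; omega) (by
      intro x
      rw [hf]
      simp only [t]
      by_cases h1 : x.2 ⊆ W ∧ x.2.card < r x.1
      · rw [if_pos ⟨h1.1, h1.2.le⟩, if_pos h1]
        obtain ⟨c, hc⟩ : ∃ c, r x.1 - x.2.card = c + 1 :=
          ⟨_, (Nat.succ_pred_eq_of_pos (by omega)).symm⟩
        rw [hc, Nat.add_sub_cancel]
        exact (Nat.add_one_mul_choose_eq m c).symm
      · rw [if_neg h1, mul_zero]
        split_ifs with h2
        · rw [show r x.1 - x.2.card = 0 by
            have : ¬ x.2.card < r x.1 := fun h => h1 ⟨h2.1, h⟩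
            omega, mul_zero]
        · rw [zero_mul])
  have hfW : ∀ j, (f j).2 ⊆ W ∧ (f j).2.card < r (f j).1 := by
    intro j
    have : 0 < t (f j) := by
      rw [← hft]
      exact Finset.card_pos.mpr ⟨j, by simp⟩
    by_contra hc
    simp [t, hc] at this
  have hvf : ∀ j, v ∉ (f j).2 := fun j hj => hv ((hfW j).1 hj)
  let g : J → ι × Finset α := fun j => ((f j).1, insert v (f j).2)
  -- The subtraction is not truncated, since `hfN` gives `N j (f j) > 0`.
  let N' : J → ι × Finset α → ℕ := fun j x =>
    N j x + (if x = g j then 1 else 0) - (if x = f j then 1 else 0)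
  have hN' : ∀ j x, N' j x + (if x = f j then 1 else 0) = N j x + (if x = g j then 1 else 0) := by
    intro j x
    have := hfN j
    simp only [N']
    by_cases hx : x = f j
    · subst hx; simp; omega
    · simp [hx]
  have hsum : ∀ j (u : ι × Finset α → ℕ),
      ∑ x, N' j x * u x + u (f j) = ∑ x, N j x * u x + u (g j) := by
    intro j u
    have : ∑ x, (N' j x + (if x = f j then 1 else 0)) * u x =
        ∑ x, (N j x + (if x = g j then 1 else 0)) * u x :=
      Finset.sum_congr rfl fun x _ => by rw [hN']
    simpa [add_mul, Finset.sum_add_distrib] using this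
  refine ⟨N', ?_, ?_, ?_⟩
  · intro j
    have h1 := hsum j fun x => r x.1 - x.2.card
    have h2 := h.sum_missing j
    have h3 := (hfW j).2
    have h4 : (insert v (f j).2).card = (f j).2.card + 1 := Finset.card_insert_of_notMem (hvf j)
    simp only [g, h4] at h1
    rw [hcard]
    omega
  · rintro ⟨i, S⟩
    rw [hm2]
    have h1 : ∑ j, N' j (i, S) + t (i, S) = ∑ j, N j (i, S) +
        (Finset.univ.filter fun j => g j = (i, S)).card := by
      have : ∑ j, (N' j (i, S) + (if (i, S) = f j then 1 else 0)) =
        ∑ j, (N j (i, S) + (if (i, S) = g j then 1 else 0)) :=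
        Finset.sum_congr rfl fun j _ => hN' j _
      rw [Finset.sum_add_distrib, Finset.sum_add_distrib] at this
      rw [← hft (i, S), Finset.card_filter, Finset.card_filter]
      simpa [eq_comm] using this
    by_cases hvS : v ∈ S
    · have hSW : ¬ S ⊆ W := fun hc => hv (hc hvS)
      have hg : (Finset.univ.filter fun j => g j = (i, S)) =
          Finset.univ.filter fun j => f j = (i, S.erase v) := by
        ext j
        simp only [g, Finset.mem_filter, Finset.mem_univ, true_and, Prod.ext_iff]
        refine and_congr_right fun _ => ⟨fun hj => ?_, fun hj => ?_⟩
        · rw [← hj, Finset.erase_insert (hvf j)]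
        · rw [hj, Finset.insert_erase hvS]
      have hc : (S.erase v).card + 1 = S.card := Finset.card_erase_add_one hvS
      rw [hg, hft, hf] at h1
      simp only [t, hSW, false_and, if_false, add_zero, zero_add, ← Finset.subset_insert_iff] at h1
      rw [h1]
      simp only
      refine if_congr (and_congr_right fun _ => by omega) ?_ rfl
      congr 1
      omega
    · have hg : (Finset.univ.filter fun j => g j = (i, S)) = ∅ := by
        refine Finset.filter_eq_empty_iff.mpr fun j _ hj => hvS ?_
        rw [show S = insert v (f j).2 from (Prod.ext_iff.mp hj).2.symm]
        exact Finset.mem_insert_self _ _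
      have hS : S ⊆ insert v W ↔ S ⊆ W := Finset.subset_insert_iff_of_notMem hvS
      rw [hg, hf] at h1
      simp only [t, Finset.card_empty, add_zero] at h1
      simp only [hS]
      by_cases h2 : S ⊆ W ∧ S.card < r i
      · obtain ⟨c, hc⟩ : ∃ c, r i - S.card = c + 1 :=
          ⟨_, (Nat.succ_pred_eq_of_pos (by omega)).symm⟩
        rw [if_pos h2, if_pos ⟨h2.1, h2.2.le⟩, hc, Nat.add_sub_cancel,
          Nat.choose_succ_succ] at h1
        rw [if_pos ⟨h2.1, h2.2.le⟩, hc]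
        simp only [Nat.succ_eq_add_one] at h1
        omega
      · rw [if_neg h2] at h1
        rw [← add_zero (∑ j, N' j (i, S)), h1]
        split_ifs with h3
        · rw [show r i - S.card = 0 by
            have : ¬ S.card < r i := fun h => h2 ⟨h3.1, h⟩
            omega]
          simp
        · rfl
  · intro j w hw
    have h1 := hsum j fun x => if w ∈ x.2 then 1 else 0
    rcases Finset.mem_insert.mp hw with rfl | hw
    · have h2 : ∑ x, N j x * (if w ∈ x.2 then 1 else 0) = 0 := by
        refine Finset.sum_eq_zero fun x _ => ?_
        by_cases hx : w ∈ x.2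
        · have h3 := hf x
          rw [if_neg fun hc => hv (hc.1 hx), Finset.sum_eq_zero_iff] at h3
          rw [h3 j (Finset.mem_univ j), zero_mul]
        · simp [hx]
      rw [h2] at h1
      simpa [g, hvf j] using h1
    · have h2 := h.sum_incident j w hw
      have h3 : w ≠ v := fun hc => hv (hc ▸ hw)
      rw [h2] at h1
      simp only [g, Finset.mem_insert, h3, false_or] at h1
      omega

/-- **Baranyai's theorem**, for several edge sizes: if every factor `j` is to have `a j i` edges of
size `r i` and the obvious counting conditions hold, then there is a factorization of the
(multi-)hypergraph of all sets of size `r i` with this distribution of sizes. -/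
theorem exists_factorization_of_counts {α J ι : Type*} [Fintype α] [DecidableEq α] [Fintype J]
    [Fintype ι] (r : ι → ℕ) (a : J → ι → ℕ)
    (h1 : ∀ j, ∑ i, a j i * r i = Fintype.card α)
    (h2 : ∀ i, ∑ j, a j i = (Fintype.card α).choose (r i)) :
    ∃ N : J → ι × Finset α → ℕ, (∀ x, ∑ j, N j x = if x.2.card = r x.1 then 1 else 0) ∧
      ∀ j v, ∑ x, N j x * (if v ∈ x.2 then 1 else 0) = 1 := by
  have key : ∀ W : Finset α, ∃ N : J → ι × Finset α → ℕ, IsPartialFactorization r W N := by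
    intro W
    induction W using Finset.induction_on with
    | empty =>
      refine ⟨fun j x => if x.2 = ∅ then a j x.1 else 0, ?_, ?_, by simp⟩
      · intro j
        simp [Fintype.sum_prod_type, ← h1 j, ite_mul]
      · rintro ⟨i, S⟩
        by_cases hS : S = ∅
        · simp [hS, h2]
        · simp [hS]
    | insert v W hv ih =>
      obtain ⟨N, hN⟩ := ih
      exact hN.exists_insert hv
  obtain ⟨N, hN⟩ := key Finset.univ
  refine ⟨N, fun x => ?_, fun j v => hN.sum_incident j v (Finset.mem_univ v)⟩
  rw [hN.sum_factors, Finset.card_univ, Nat.sub_self]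
  simp only [Finset.subset_univ, true_and]
  rcases lt_trichotomy x.2.card (r x.1) with h | h | h
  · rw [if_pos h.le, if_neg h.ne, Nat.choose_eq_zero_of_lt (by omega)]
  · simp [h]
  · rw [if_neg (by omega), if_neg h.ne']

/-! ### Reduction to the distribution of edge sizes -/

/-- `a j i` is the number of edges of size `i + 1` of the factor `j`, for a family of factors
that could be a `1`-factorization of `K_n^{≤ k}` as far as the numbers of edges are concerned. -/
def IsFactorDistribution {J : Type*} [Fintype J] (n k : ℕ) (a : J → ℕ → ℕ) : Prop :=
  (∀ j, ∑ i ∈ Finset.range k, a j i * (i + 1) = n) ∧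
    ∀ i < k, ∑ j, a j i = n.choose (i + 1)

theorem existsUnique_pos_of_sum_eq_one {ι : Type*} [Fintype ι] {f : ι → ℕ} (h : ∑ x, f x = 1) :
    ∃! x, 0 < f x := by
  classical
  obtain ⟨x, -, hx⟩ := Finset.exists_ne_zero_of_sum_ne_zero (h.trans_ne one_ne_zero)
  refine ⟨x, Nat.pos_of_ne_zero hx, fun y (hy : 0 < f y) => ?_⟩
  by_contra hne
  have := Finset.sum_le_sum_of_subset (f := f) (Finset.subset_univ {x, y})
  rw [Finset.sum_pair (Ne.symm hne), h] at this
  omega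

theorem IsFactorDistribution.isHypergraphFactorable {J : Type*} [Fintype J] {n k : ℕ}
    {a : J → ℕ → ℕ} (ha : IsFactorDistribution n k a) :
    IsHypergraphFactorable 1 (completeHypergraphLE n k) := by
  classical
  obtain ⟨N, hN1, hN2⟩ := exists_factorization_of_counts (α := Fin n)
    (fun i : Fin k => (i : ℕ) + 1) (fun j i => a j i)
    (fun j => by rw [Fintype.card_fin, ← ha.1 j, Finset.sum_range])
    (fun i => by rw [Fintype.card_fin]; exact ha.2 i i.2)
  have hcard : ∀ j x, 0 < N j x → x.2.card = x.1 + 1 := by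
    intro j x hx
    by_contra hc
    have := hN1 x
    rw [if_neg hc, Finset.sum_eq_zero_iff] at this
    exact hx.ne' (this j (Finset.mem_univ j))
  let H : J → Hypergraph (Fin n) := fun j =>
    { vertexSet := Set.univ
      edgeSet := {e | ∃ x, 0 < N j x ∧ e = (x.2 : Set (Fin n))}
      subset_vertexSet_of_mem_edgeSet' := fun _ _ => Set.subset_univ _ }
  refine ⟨Set.range H, ?_, ?_⟩
  · rintro _ ⟨j, rfl⟩
    refine ⟨rfl, ?_, fun v _ => ?_⟩
    · rintro _ ⟨x, hx, rfl⟩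
      have := hcard j x hx
      refine ⟨?_, ?_⟩
      · rw [Finset.coe_nonempty, ← Finset.card_pos]
        omega
      · rw [Set.ncard_coe_finset]
        omega
    · obtain ⟨x, hx, hxu⟩ := existsUnique_pos_of_sum_eq_one (hN2 j v)
      simp only at hx hxu
      rw [Nat.cast_one, Set.encard_eq_one]
      refine ⟨x.2, Set.eq_singleton_iff_unique_mem.mpr ⟨⟨⟨x, ?_, rfl⟩, ?_⟩, ?_⟩⟩
      · exact Nat.pos_of_mul_pos_right hx
      · by_contra hc
        simp [show v ∉ x.2 from hc] at hx
      · rintro _ ⟨⟨y, hy, rfl⟩, hv⟩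
        rw [hxu y (by simpa [show v ∈ y.2 from hv] using hy)]
  · rintro e ⟨he1, he2⟩
    lift e to Finset (Fin n) using e.toFinite
    rw [Set.ncard_coe_finset] at he2
    rw [Finset.coe_nonempty, ← Finset.card_pos] at he1
    let x : Fin k × Finset (Fin n) := (⟨e.card - 1, by omega⟩, e)
    have hx : ∑ j, N j x = 1 := by
      rw [hN1, if_pos]
      simp only [x]
      omega
    obtain ⟨j, hj, hju⟩ := existsUnique_pos_of_sum_eq_one hx
    refine ⟨H j, ⟨⟨j, rfl⟩, x, hj, rfl⟩, ?_⟩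
    rintro _ ⟨⟨j', rfl⟩, y, hy, hey⟩
    have h2 := Finset.coe_injective hey
    have h1 := hcard j' y hy
    have hyx : y = x := by
      refine Prod.ext (Fin.ext ?_) h2.symm
      simp only [x]
      rw [h2]
      omega
    rw [hju j' (hyx ▸ hy)]

theorem exists_isFactorDistribution {n k : ℕ}
    (h : IsHypergraphFactorable 1 (completeHypergraphLE n k)) :
    ∃ (J : Type) (_ : Fintype J) (a : J → ℕ → ℕ), IsFactorDistribution n k a := by
  classical
  let E : Hypergraph (Fin n) → Finset (Fin n) → Prop := fun F S => (S : Set (Fin n)) ∈ F.edgeSet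
  obtain ⟨𝓕, h1, h2⟩ := h
  have : Finite (Hypergraph (Fin n)) :=
    Finite.of_injective (fun H => (H.vertexSet, H.edgeSet)) fun H K hHK => by
      rw [Prod.mk.injEq] at hHK
      exact Hypergraph.ext hHK.1 hHK.2
  have : Fintype 𝓕 := Fintype.ofFinite _
  refine ⟨𝓕, inferInstance, fun F i => (Finset.univ.filter fun S : Finset (Fin n) =>
    E F.1 S ∧ S.card = i + 1).card, fun F => ?_, fun i hi => ?_⟩
  · obtain ⟨-, hF1, hF2⟩ := h1 F.1 F.2
    have hF3 : ∀ S : Finset (Fin n), E F.1 S → 0 < S.card ∧ S.card ≤ k := by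
      intro S hS
      have := hF1 hS
      refine ⟨?_, ?_⟩
      · rw [Finset.card_pos, ← Finset.coe_nonempty]; exact this.1
      · rw [← Set.ncard_coe_finset]; exact this.2
    have hF4 : ∀ v, (Finset.univ.filter fun S : Finset (Fin n) =>
        E F.1 S ∧ v ∈ S).card = 1 := by
      intro v
      have h3 := hF2 v (Set.mem_univ v)
      have h4 : {e | e ∈ F.1.edgeSet ∧ v ∈ e} = (fun S : Finset (Fin n) => (S : Set (Fin n))) ''
          (Finset.univ.filter fun S : Finset (Fin n) =>
            E F.1 S ∧ v ∈ S : Finset (Finset (Fin n))) := by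
        ext e
        constructor
        · intro he
          lift e to Finset (Fin n) using e.toFinite
          exact ⟨e, by simpa [E] using he, rfl⟩
        · rintro ⟨S, hS, rfl⟩
          simpa [E] using hS
      rw [h4, Finset.coe_injective.encard_image, Set.encard_coe_eq_coe_finsetCard] at h3
      exact_mod_cast h3
    calc _ = ∑ i ∈ Finset.range k, ∑ S : Finset (Fin n) with E F.1 S ∧ S.card = i + 1,
          S.card := by
          refine Finset.sum_congr rfl fun i _ => ?_
          rw [Finset.sum_congr rfl fun S hS => (Finset.mem_filter.mp hS).2.2]
          simp
      -- Edges are non-empty, so `S.card - 1` is the true index of the size class.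
      _ = ∑ i ∈ Finset.range k, ∑ S : Finset (Fin n) with E F.1 S,
          if S.card - 1 = i then S.card else 0 := by
          refine Finset.sum_congr rfl fun i _ => ?_
          rw [← Finset.sum_filter, Finset.filter_filter]
          refine Finset.sum_congr (Finset.filter_congr fun S _ => ?_) fun _ _ => rfl
          refine and_congr_right fun hS => ?_
          have := hF3 S hS
          omega
      _ = ∑ S : Finset (Fin n) with E F.1 S, S.card := by
          rw [Finset.sum_comm]
          refine Finset.sum_congr rfl fun S hS => ?_
          have := hF3 S (Finset.mem_filter.mp hS).2
          rw [Finset.sum_ite_eq, if_pos (Finset.mem_range.mpr (by omega))]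
      _ = ∑ S : Finset (Fin n) with E F.1 S, ∑ v, if v ∈ S then 1 else 0 := by simp
      _ = ∑ v, (Finset.univ.filter fun S : Finset (Fin n) =>
          E F.1 S ∧ v ∈ S).card := by
          rw [Finset.sum_comm]
          refine Finset.sum_congr rfl fun v _ => ?_
          rw [← Finset.card_filter, Finset.filter_filter]
      _ = n := by simp [hF4]
  · calc _ = ∑ F : 𝓕, ∑ S ∈ Finset.powersetCard (i + 1) Finset.univ,
          if E F.1 S then 1 else 0 := by
          refine Finset.sum_congr rfl fun F _ => ?_
          rw [← Finset.card_filter]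
          refine congrArg Finset.card (Finset.ext fun S => ?_)
          simp [and_comm]
      _ = ∑ S ∈ Finset.powersetCard (i + 1) (Finset.univ : Finset (Fin n)), 1 := by
          rw [Finset.sum_comm]
          refine Finset.sum_congr rfl fun S hS => ?_
          rw [← Finset.card_filter, Finset.card_eq_one]
          have hc := (Finset.mem_powersetCard.mp hS).2
          obtain ⟨F, ⟨hF, hSF⟩, hu⟩ := h2 S ⟨by
            rw [Finset.coe_nonempty, ← Finset.card_pos]; omega, by
            rw [Set.ncard_coe_finset]; omega⟩
          refine ⟨⟨F, hF⟩, Finset.eq_singleton_iff_unique_mem.mpr ⟨by simpa [E] using hSF, ?_⟩⟩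
          intro G hG
          exact Subtype.ext (hu G.1 ⟨G.2, (Finset.mem_filter.mp hG).2⟩)
      _ = n.choose (i + 1) := by simp

/-! ### Counting edges and factors -/

/-- The number of subsets of size less than `t` of a set of size `m`. -/
def chooseSum (m t : ℕ) : ℕ := ∑ i ∈ Finset.range t, m.choose i

theorem chooseSum_zero (m : ℕ) : chooseSum m 0 = 0 := rfl

theorem chooseSum_succ (m t : ℕ) : chooseSum m (t + 1) = chooseSum m t + m.choose t :=
  Finset.sum_range_succ _ _

/-- Pascal's rule, summed over the edges of size at most t; the extra 1 is the empty set. -/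
theorem sum_choose_succ_add_one (m t : ℕ) :
    ∑ i ∈ Finset.range t, (m + 1).choose (i + 1) + 1 = 2 * chooseSum m t + m.choose t := by
  induction t with
  | zero => simp [chooseSum_zero]
  | succ t ih =>
    rw [Finset.sum_range_succ, chooseSum_succ, Nat.choose_succ_succ']
    omega

/-- Double counting of incidences: `chooseSum m t` is the degree of a vertex. -/
theorem sum_choose_succ_mul (m t : ℕ) :
    ∑ i ∈ Finset.range t, (m + 1).choose (i + 1) * (i + 1) = (m + 1) * chooseSum m t := by
  simp [chooseSum, Finset.mul_sum, Nat.add_one_mul_choose_eq]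

namespace IsFactorDistribution

variable {J : Type*} [Fintype J] {m k : ℕ} {a : J → ℕ → ℕ}

theorem card_eq (ha : IsFactorDistribution (m + 1) k a) : Fintype.card J = chooseSum m k := by
  have h : (m + 1) * Fintype.card J = (m + 1) * chooseSum m k := by
    rw [← sum_choose_succ_mul]
    calc (m + 1) * Fintype.card J = ∑ j, ∑ i ∈ Finset.range k, a j i * (i + 1) := by
          simp [ha.1, mul_comm]
      _ = ∑ i ∈ Finset.range k, (∑ j, a j i) * (i + 1) := by
          rw [Finset.sum_comm]; simp [Finset.sum_mul]
      _ = _ := Finset.sum_congr rfl fun i hi => by rw [ha.2 i (Finset.mem_range.mp hi)]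
  exact Nat.eq_of_mul_eq_mul_left (by omega) h

theorem sum_sum_add_one (ha : IsFactorDistribution (m + 1) k a) {t : ℕ} (ht : t ≤ k) :
    ∑ j, ∑ i ∈ Finset.range t, a j i + 1 = 2 * chooseSum m t + m.choose t := by
  rw [Finset.sum_comm, ← sum_choose_succ_add_one]
  congr 1
  exact Finset.sum_congr rfl fun i hi => ha.2 i ((Finset.mem_range.mp hi).trans_le ht)

/-! ### Necessary conditions from counting -/

/-- If the remainder `r` of `n` modulo `k = κ + 1` is not zero, then every factor has an edge of
size less than `k`, and at least two of them or one of size `r`. -/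
theorem two_le_of_mod {κ q r : ℕ} {b : ℕ → ℕ}
    (hb : ∑ i ∈ Finset.range (κ + 1), b i * (i + 1) = q * (κ + 1) + r) (hr0 : 0 < r)
    (hr : r ≤ κ) : 2 ≤ ∑ i ∈ Finset.range κ, b i + b (r - 1) := by
  rw [Finset.sum_range_succ] at hb
  by_contra! hlt
  have hmod : (∑ i ∈ Finset.range κ, b i * (i + 1)) % (κ + 1) = r := by
    have := congrArg (· % (κ + 1)) hb
    simpa [Nat.add_mod, Nat.mod_eq_of_lt (Nat.lt_succ_of_le hr)] using this
  rcases Nat.eq_zero_or_pos (∑ i ∈ Finset.range κ, b i) with h0 | hpos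
  · rw [Finset.sum_eq_zero_iff] at h0
    rw [Finset.sum_eq_zero fun i hi => by rw [h0 i hi, zero_mul]] at hmod
    simp at hmod
    omega
  · obtain ⟨i, hi, hbi⟩ := Finset.exists_ne_zero_of_sum_ne_zero hpos.ne'
    have h1 := Finset.add_sum_erase _ b hi
    have h0 : ∑ x ∈ (Finset.range κ).erase i, b x = 0 := by omega
    have hb1 : b i = 1 := by omega
    rw [Finset.sum_eq_zero_iff] at h0
    rw [← Finset.add_sum_erase _ _ hi, Finset.sum_eq_zero fun x hx => by rw [h0 x hx, zero_mul],
      hb1, add_zero, one_mul, Nat.mod_eq_of_lt (by have := Finset.mem_range.mp hi; omega)] at hmod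
    have : b (r - 1) = 1 := by rw [← hmod, Nat.add_sub_cancel, hb1]
    omega

theorem choose_lt_choose_of_mod {κ q r : ℕ} (ha : IsFactorDistribution (m + 1) (κ + 1) a)
    (hm : m + 1 = q * (κ + 1) + r) (hr0 : 0 < r) (hr : r ≤ κ) :
    m.choose κ < (m + 1).choose r := by
  have h1 : ∑ _j : J, 2 ≤ ∑ j, (∑ i ∈ Finset.range κ, a j i + a j (r - 1)) :=
    Finset.sum_le_sum fun j _ => two_le_of_mod ((ha.1 j).trans hm) hr0 hr
  have h2 := ha.sum_sum_add_one (Nat.le_succ κ)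
  have h3 := ha.2 (r - 1) (by omega)
  rw [Nat.sub_add_cancel hr0] at h3
  rw [Finset.sum_add_distrib, h3, Finset.sum_const, Finset.card_univ, ha.card_eq, smul_eq_mul,
    chooseSum_succ] at h1
  omega

/-- If `n = Q k - δ` with `δ ≤ 1`, a factor has at least `Q` edges, and if it has only `Q` of them
then at least `Q - δ` have size `k`. -/
theorem mul_le_of_add_eq {κ n Q δ : ℕ} {b : ℕ → ℕ} (hκ : 0 < κ)
    (hb : ∑ i ∈ Finset.range (κ + 1), b i * (i + 1) = n) (hn : n + δ = Q * (κ + 1))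
    (hδ : δ ≤ 1) :
    (Q - δ) * (Q + 1) ≤ b κ + (Q - δ) * ∑ i ∈ Finset.range (κ + 1), b i := by
  set N := ∑ i ∈ Finset.range (κ + 1), b i with hN
  -- The total deficit of the factor is N k - n, and each edge of size below k contributes at least
  -- 1 to it. For N = Q at most δ edges can be that small.
  have h1 : ∑ i ∈ Finset.range κ, b i * (κ - i) + n = N * (κ + 1) := by
    have : ∑ i ∈ Finset.range (κ + 1), b i * (κ - i) + n = N * (κ + 1) := by
      rw [← hb, ← Finset.sum_add_distrib, hN, Finset.sum_mul]
      refine Finset.sum_congr rfl fun i hi => ?_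
      have := Finset.mem_range.mp hi
      rw [← mul_add]
      congr 1
      omega
    rw [Finset.sum_range_succ] at this
    simpa using this
  have h2 : ∑ i ∈ Finset.range κ, b i ≤ ∑ i ∈ Finset.range κ, b i * (κ - i) := by
    refine Finset.sum_le_sum fun i hi => Nat.le_mul_of_pos_right _ ?_
    have := Finset.mem_range.mp hi
    omega
  have h3 : N = ∑ i ∈ Finset.range κ, b i + b κ := Finset.sum_range_succ _ _
  have hQN : Q ≤ N := by
    by_contra! hlt
    have : (N + 1) * (κ + 1) ≤ Q * (κ + 1) := Nat.mul_le_mul_right _ hlt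
    rw [add_mul] at this
    omega
  rcases hQN.eq_or_lt with h | h
  · rw [← h] at h1 h3 ⊢
    have : Q - δ ≤ b κ := by omega
    rw [mul_add, mul_one]
    omega
  · exact (Nat.mul_le_mul_left _ h).trans (Nat.le_add_left _ _)

theorem mul_chooseSum_le {κ Q δ : ℕ} (ha : IsFactorDistribution (m + 1) (κ + 1) a)
    (hκ : 0 < κ) (hn : m + 1 + δ = Q * (κ + 1)) (hδ : δ ≤ 1) :
    (Q - δ) * (Q + 1) * chooseSum m (κ + 1) + (Q - δ) ≤
      (m + 1).choose (κ + 1) + (Q - δ) * (2 * chooseSum m (κ + 1) + m.choose (κ + 1)) := by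
  have h1 : ∑ _j : J, (Q - δ) * (Q + 1) ≤
      ∑ j, (a j κ + (Q - δ) * ∑ i ∈ Finset.range (κ + 1), a j i) :=
    Finset.sum_le_sum fun j _ => mul_le_of_add_eq hκ (ha.1 j) hn hδ
  rw [Finset.sum_add_distrib, ← Finset.mul_sum, ha.2 κ (Nat.lt_succ_self κ), Finset.sum_const,
    Finset.card_univ, ha.card_eq, smul_eq_mul] at h1
  rw [← ha.sum_sum_add_one le_rfl]
  rw [← Finset.mul_sum] at h1
  linarith

/-- For n = q k both C(n, k) and C(m, k) are multiples of C(m, k-1), by q and q - 1, and the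
averaged inequality collapses to one about C(m, k-1). -/
theorem lt_choose_of_dvd {κ q : ℕ} (ha : IsFactorDistribution (m + 1) (κ + 1) a)
    (hκ : 0 < κ) (hq : 0 < q) (hn : m + 1 = q * (κ + 1)) :
    (q - 1) * chooseSum m κ < m.choose κ := by
  have h1 := ha.mul_chooseSum_le (δ := 0) hκ hn (by omega)
  have h2 : (m + 1).choose (κ + 1) = q * m.choose κ := by
    have := Nat.add_one_mul_choose_eq m κ
    rw [hn] at this
    rw [← hn] at this
    refine Nat.eq_of_mul_eq_mul_right (Nat.succ_pos κ) ?_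
    rw [Nat.succ_eq_add_one, ← this, hn]
    ring
  have h3 := Nat.choose_succ_succ' m κ
  rw [chooseSum_succ] at h1
  obtain ⟨p, rfl⟩ : ∃ p, q = p + 1 := ⟨q - 1, by omega⟩
  have h4 : m.choose (κ + 1) = p * m.choose κ := by linarith
  rw [h2, h4] at h1
  simp only [Nat.sub_zero, Nat.add_sub_cancel] at h1 ⊢
  have : (p + 1) * (p * chooseSum m κ + 1) ≤ (p + 1) * m.choose κ := by nlinarith
  exact Nat.le_of_mul_le_mul_left this (Nat.succ_pos p)

theorem lt_choose_of_dvd_succ {κ q : ℕ} (ha : IsFactorDistribution (m + 1) (κ + 2) a)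
    (hn : m + 2 = (q + 2) * (κ + 2)) :
    (q + 1) * chooseSum m κ < m.choose κ := by
  have h1 := ha.mul_chooseSum_le (δ := 1) (Nat.succ_pos κ) (by rw [hn]) le_rfl
  have h2 := Nat.add_one_mul_choose_eq m (κ + 1)
  have h3 := Nat.choose_succ_succ' m (κ + 1)
  have h4 := Nat.choose_succ_right_eq m κ
  have h5 : m - κ = (q + 1) * (κ + 2) := by
    have : (q + 2) * (κ + 2) = (q + 1) * (κ + 2) + (κ + 2) := by ring
    omega
  rw [h5] at h4
  rw [chooseSum_succ, chooseSum_succ] at h1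
  simp only [show q + 2 - 1 = q + 1 by omega] at h1
  zify at *
  generalize (m.choose κ : ℤ) = b at *
  generalize (m.choose (κ + 1) : ℤ) = B at *
  generalize (m.choose (κ + 1 + 1) : ℤ) = D at *
  generalize ((m + 1).choose (κ + 1 + 1) : ℤ) = C at *
  generalize (chooseSum m κ : ℤ) = g at *
  -- B - (q + 1) b equals C(m, k-1) / k; naming it this way avoids division when C and D are
  -- expressed by B and b.
  have hB : B = (κ + 2) * (B - (q + 1) * b) := by linarith
  have hC : C = (q + 2) * B - (B - (q + 1) * b) := by
    have : ((κ : ℤ) + 2) * C = (κ + 2) * ((q + 2) * B - (B - (q + 1) * b)) := by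
      rw [mul_sub, ← hB]
      linear_combination -h2 + B * hn
    exact mul_left_cancel₀ (by positivity) this
  have hD : D = C - B := by linarith
  have : ((q : ℤ) + 1) * ((q + 1) * g + 1) ≤ (q + 1) * b := by
    rw [hD, hC] at h1
    nlinarith
  have := le_of_mul_le_mul_left this (by positivity)
  linarith

end IsFactorDistribution

/-! ### Binomial estimates and the lower bounds on n -/

/-- C(m+1, r) ≤ C(m, r+1) by comparing ratios, and then binomial coefficients grow up to the middle.
This excludes the remainders 0 < r < k - 1. -/
theorem choose_succ_le_choose_of_le {m r κ : ℕ} (hr : r < κ) (hm : 2 * κ + 2 + r ≤ m + 1) :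
    (m + 1).choose r ≤ m.choose κ := by
  have h1 : (m + 1).choose r ≤ m.choose (r + 1) := by
    have h2 := Nat.choose_mul_succ_eq m r
    have h3 := Nat.choose_succ_right_eq m r
    obtain ⟨x, hx⟩ : ∃ x, m = r + x := ⟨m - r, by omega⟩
    have h4 : m - r = x := by omega
    have h5 : m + 1 - r = x + 1 := by omega
    rw [h5] at h2
    rw [h4] at h3
    have h6 : (m + 1) * (r + 1) ≤ x * (x + 1) := by
      rw [hx]
      nlinarith
    refine Nat.le_of_mul_le_mul_right (c := (x + 1) * (r + 1)) ?_ (by positivity)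
    calc (m + 1).choose r * ((x + 1) * (r + 1)) = m.choose r * ((m + 1) * (r + 1)) := by
          rw [← mul_assoc, ← h2]; ring
      _ ≤ m.choose r * (x * (x + 1)) := Nat.mul_le_mul_left _ h6
      _ = m.choose (r + 1) * ((x + 1) * (r + 1)) := by
          rw [← mul_assoc, ← h3]; ring
  refine h1.trans ?_
  obtain ⟨d, rfl⟩ : ∃ d, κ = r + 1 + d := ⟨κ - (r + 1), by omega⟩
  clear hr h1
  induction d with
  | zero => exact le_rfl
  | succ d ih =>
    exact (ih (by omega)).trans (Nat.choose_le_succ_of_lt_half_left (by omega))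

theorem le_mul_add_add_of_ratios {b₀ b₁ b₂ b₃ x₁ x₂ x₃ y₁ y₂ y₃ c : ℕ} (hy₁ : 0 < y₁)
    (hy₂ : 0 < y₂) (hy₃ : 0 < y₃) (h₁ : b₀ * y₁ = b₁ * x₁) (h₂ : b₁ * y₂ = b₂ * x₂)
    (h₃ : b₂ * y₃ = b₃ * x₃)
    (h : x₁ * x₂ * x₃ ≤ c * y₁ * (x₂ * x₃ + y₂ * x₃ + y₂ * y₃)) :
    b₀ ≤ c * (b₁ + b₂ + b₃) := by
  refine Nat.le_of_mul_le_mul_right (c := y₁ * y₂ * y₃) ?_ (by positivity)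
  have e₁ : b₁ * y₂ * y₃ = b₃ * (x₂ * x₃) := by rw [h₂, mul_right_comm, h₃]; ring
  calc b₀ * (y₁ * y₂ * y₃) = (b₀ * y₁) * y₂ * y₃ := by ring
    _ = x₁ * (b₁ * y₂ * y₃) := by rw [h₁]; ring
    _ = b₃ * (x₁ * x₂ * x₃) := by rw [e₁]; ring
    _ ≤ b₃ * (c * y₁ * (x₂ * x₃ + y₂ * x₃ + y₂ * y₃)) := Nat.mul_le_mul_left _ h
    _ = c * y₁ * (b₃ * (x₂ * x₃) + y₂ * (b₃ * x₃) + y₂ * y₃ * b₃) := by ring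
    _ = c * (b₁ + b₂ + b₃) * (y₁ * y₂ * y₃) := by rw [← e₁, ← h₃]; ring

/-- Only the last three terms of the sum are kept; their ratios to C(m, κ+3) turn the claim into a
polynomial inequality. -/
theorem choose_le_mul_chooseSum {m κ c x : ℕ} (hm : m = x + κ + 2)
    (h : x * (x + 1) * (x + 2) ≤ c * (κ + 3) * ((x + 1) * (x + 2) + (κ + 2) * (x + 2) +
      (κ + 2) * (κ + 1))) : m.choose (κ + 3) ≤ c * chooseSum m (κ + 3) := by
  have h₁ := Nat.choose_succ_right_eq m (κ + 2)
  have h₂ := Nat.choose_succ_right_eq m (κ + 1)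
  have h₃ := Nat.choose_succ_right_eq m κ
  rw [show m - (κ + 2) = x by omega] at h₁
  rw [show m - (κ + 1) = x + 1 by omega] at h₂
  rw [show m - κ = x + 2 by omega] at h₃
  refine (le_mul_add_add_of_ratios (Nat.succ_pos _) (Nat.succ_pos _) (Nat.succ_pos _)
    h₁ h₂ h₃ h).trans (Nat.mul_le_mul_left _ ?_)
  rw [chooseSum_succ, chooseSum_succ, chooseSum_succ]
  omega

namespace IsFactorDistribution

variable {J : Type*} [Fintype J] {m k : ℕ} {a : J → ℕ → ℕ}

theorem le_add_two_of_dvd {q : ℕ} (ha : IsFactorDistribution (m + 1) k a)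
    (hn : m + 1 = q * k) (hq : 3 ≤ q) : k ≤ q + 2 := by
  by_contra! hlt
  -- Measuring q and k from their least values leaves a polynomial in u and v with no negative
  -- terms.
  obtain ⟨v, rfl⟩ : ∃ v, q = v + 3 := ⟨q - 3, by omega⟩
  obtain ⟨u, rfl⟩ : ∃ u, k = u + v + 6 := ⟨k - v - 6, by omega⟩
  have h := ha.lt_choose_of_dvd (κ := u + v + 5) (by omega) (by omega) hn
  refine absurd h (not_lt.mpr (choose_le_mul_chooseSum (κ := u + v + 2)
    (x := (v + 2) * (u + v + 6) + 1) (by linarith) ?_))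
  rw [show v + 3 - 1 = v + 2 by omega]
  zify
  rw [← sub_nonneg]
  ring_nf
  positivity

theorem le_of_dvd_succ {q : ℕ} (ha : IsFactorDistribution (m + 1) k a)
    (hn : m + 2 = q * k) (hq : 3 ≤ q) : k ≤ 2 * q + 2 := by
  by_contra! hlt
  obtain ⟨v, rfl⟩ : ∃ v, q = v + 3 := ⟨q - 3, by omega⟩
  obtain ⟨u, rfl⟩ : ∃ u, k = u + 2 * v + 9 := ⟨k - 2 * v - 9, by omega⟩
  have h := ha.lt_choose_of_dvd_succ (q := v + 1) (κ := u + 2 * v + 7) hn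
  refine absurd h (not_lt.mpr (choose_le_mul_chooseSum (κ := u + 2 * v + 4)
    (x := (v + 2) * (u + 2 * v + 9) + 1) (by linarith) ?_))
  zify
  rw [← sub_nonneg]
  ring_nf
  positivity

/-- The divisibility condition and the lower bounds on `n = m + 1` are necessary. -/
theorem dvd_or_dvd_succ (ha : IsFactorDistribution (m + 1) k a) (hk : 0 < k)
    (hkm : 2 * k < m + 1) :
    (∃ q, m + 1 = q * k ∧ k ≤ q + 2) ∨ ∃ q, m + 2 = q * k ∧ k ≤ 2 * q + 2 := by
  obtain ⟨κ, rfl⟩ : ∃ κ, k = κ + 1 := ⟨k - 1, by omega⟩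
  have hdiv := Nat.div_add_mod' (m + 1) (κ + 1)
  have hr := Nat.mod_lt (m + 1) hk
  generalize (m + 1) / (κ + 1) = q at hdiv
  generalize (m + 1) % (κ + 1) = r at hdiv hr
  rcases Nat.eq_zero_or_pos r with h0 | h0
  · left
    have hn : m + 1 = q * (κ + 1) := by omega
    refine ⟨q, hn, ha.le_add_two_of_dvd hn ?_⟩
    by_contra! hq
    have : q * (κ + 1) ≤ 2 * (κ + 1) := Nat.mul_le_mul_right _ (by omega)
    omega
  · right
    have hrκ : r = κ := by
      by_contra hne
      have h1 := ha.choose_lt_choose_of_mod hdiv.symm h0 (by omega)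
      have hq : 2 ≤ q := by
        by_contra! hq
        have : q * (κ + 1) ≤ 1 * (κ + 1) := Nat.mul_le_mul_right _ (by omega)
        omega
      have := Nat.mul_le_mul_right (κ + 1) hq
      exact absurd h1 (not_lt.mpr (choose_succ_le_choose_of_le (by omega) (by omega)))
    have hn : m + 2 = (q + 1) * (κ + 1) := by
      rw [add_mul]
      omega
    refine ⟨q + 1, hn, ha.le_of_dvd_succ hn ?_⟩
    by_contra! hq
    have : q * (κ + 1) ≤ 1 * (κ + 1) := Nat.mul_le_mul_right _ (by omega)
    omega

end IsFactorDistribution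

/-! ### Factors as bins of deficits -/

namespace Multiset

theorem sum_finset_sum {ι M : Type*} [AddCommMonoid M] (s : Finset ι) (f : ι → Multiset M) :
    (∑ i ∈ s, f i).sum = ∑ i ∈ s, (f i).sum :=
  map_sum sumAddMonoidHom f s

/-- A family of multisets whose sums fall short of `σ` by multiples of `x` can be filled with
copies of `x` so that all sums are `σ`; the number of copies is determined by the total. -/
theorem exists_filling {P : Multiset (Multiset ℕ)} {x σ N c : ℕ} (hx : 0 < x)
    (hP : ∀ g ∈ P, ∃ c, g.sum + c * x = σ ∧ g.card + c ≤ N)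
    (hc : P.sum.sum + c * x = σ * P.card) :
    ∃ P' : Multiset (Multiset ℕ), P'.card = P.card ∧ P'.sum = P.sum + c • {x} ∧
      ∀ g ∈ P', g.sum = σ ∧ g.card ≤ N := by
  -- The induction produces its own filler count, for which the total identity holds; comparison
  -- with `hc` identifies it with c.
  have key : ∃ (P' : Multiset (Multiset ℕ)) (c : ℕ), P'.card = P.card ∧
      P'.sum = P.sum + c • {x} ∧ (∀ g ∈ P', g.sum = σ ∧ g.card ≤ N) ∧
      P.sum.sum + c * x = σ * P.card := by
    clear hc
    induction P using Multiset.induction_on with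
    | empty => exact ⟨0, 0, by simp⟩
    | cons g P ih =>
      obtain ⟨P', c, h1, h2, h3, h4⟩ := ih fun g hg => hP g (mem_cons_of_mem hg)
      obtain ⟨d, hd1, hd2⟩ := hP g (mem_cons_self g P)
      refine ⟨(g + d • {x}) ::ₘ P', c + d, by simp [h1], ?_, ?_, ?_⟩
      · rw [sum_cons, sum_cons, h2, add_nsmul]
        abel
      · intro g' hg'
        rcases mem_cons.mp hg' with rfl | hg'
        · simpa [sum_nsmul] using ⟨hd1, hd2⟩
        · exact h3 g' hg'
      · simp only [sum_cons, sum_add, card_cons]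
        linarith
  obtain ⟨P', c', h1, h2, h3, h4⟩ := key
  have : c' = c := Nat.eq_of_mul_eq_mul_right hx (by omega)
  exact ⟨P', h1, this ▸ h2, h3⟩

theorem sum_count_succ_mul {g : Multiset ℕ} {k : ℕ} (hg : ∀ d ∈ g, 0 < d ∧ d ≤ k) :
    ∑ i ∈ Finset.range k, g.count (i + 1) * (i + 1) = g.sum := by
  induction g using Multiset.induction_on with
  | empty => simp
  | cons d g ih =>
    have hd := hg d (mem_cons_self d g)
    rw [sum_cons, ← ih fun x hx => hg x (mem_cons_of_mem hx)]
    simp only [count_cons, add_mul, Finset.sum_add_distrib]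
    rw [add_comm, Finset.sum_eq_single (d - 1)]
    · rw [Nat.sub_add_cancel hd.1]; simp
    · intro i _ hi
      rw [if_neg (by omega), zero_mul]
    · intro h
      exact absurd (Finset.mem_range.mpr (by omega)) h

end Multiset

/-- A family of multisets of edge sizes, one for each factor, with the right total. -/
theorem exists_isFactorDistribution_of_sizes {n k : ℕ} (P : Multiset (Multiset ℕ))
    (hP : ∀ g ∈ P, g.sum = n)
    (hsum : P.sum = ∑ i ∈ Finset.range k, n.choose (i + 1) • {i + 1}) :
    ∃ (J : Type) (_ : Fintype J) (a : J → ℕ → ℕ), IsFactorDistribution n k a := by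
  have hmem : ∀ g ∈ P, ∀ d ∈ g, 0 < d ∧ d ≤ k := by
    intro g hg d hd
    have h1 : d ∈ P.sum := Multiset.mem_of_le (Multiset.single_le_sum (by simp) g hg) hd
    rw [hsum, Multiset.mem_sum] at h1
    obtain ⟨i, hi, hdi⟩ := h1
    rw [Multiset.mem_singleton.mp (Multiset.mem_of_mem_nsmul hdi)]
    have := Finset.mem_range.mp hi
    omega
  obtain ⟨l, rfl⟩ := Quot.exists_rep P
  refine ⟨Fin l.length, inferInstance, fun j i => l[j].count (i + 1), fun j => ?_, fun i hi => ?_⟩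
  · have hj : l[j] ∈ (Multiset.ofList l) := Multiset.mem_coe.mpr (List.getElem_mem _)
    rw [Multiset.sum_count_succ_mul (hmem _ hj)]
    exact hP _ hj
  · have h1 : (Multiset.ofList l).sum.count (i + 1) = n.choose (i + 1) := by
      have : (Multiset.ofList l).sum = ∑ i ∈ Finset.range k, n.choose (i + 1) • {i + 1} := hsum
      rw [this, Multiset.count_sum', Finset.sum_eq_single i]
      · simp
      · intro j _ hj
        simp [Ne.symm hj]
      · intro h
        exact absurd (Finset.mem_range.mpr hi) h
    rw [← h1]
    change _ = Multiset.countAddMonoidHom (i + 1) (Multiset.ofList l).sum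
    rw [Multiset.sum_coe, map_list_sum]
    exact Fin.sum_univ_fun_getElem l (Multiset.countAddMonoidHom (i + 1))

/-- The edges of size less than `k = t + 1` are represented by their deficits `d = k - size`, and
factors by the multisets of deficits of their edges of size less than `k`. -/
theorem exists_isFactorDistribution_of_deficits {m t : ℕ} (P : Multiset (Multiset ℕ))
    (hP : ∀ g ∈ P, ∃ N, m + 1 + g.sum = N * (t + 1) ∧ g.card ≤ N)
    (hcard : P.card = chooseSum m (t + 1))
    (hsum : P.sum = ∑ i ∈ Finset.range t, (m + 1).choose (i + 1) • {t - i}) :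
    ∃ (J : Type) (_ : Fintype J) (a : J → ℕ → ℕ), IsFactorDistribution (m + 1) (t + 1) a := by
  have hmem : ∀ g ∈ P, ∀ d ∈ g, d ≤ t := by
    intro g hg d hd
    have h1 : d ∈ P.sum := Multiset.mem_of_le (Multiset.single_le_sum (by simp) g hg) hd
    rw [hsum, Multiset.mem_sum] at h1
    obtain ⟨i, hi, hdi⟩ := h1
    rw [Multiset.mem_singleton.mp (Multiset.mem_of_mem_nsmul hdi)]
    exact Nat.sub_le _ _
  have hrefl : ∀ g : Multiset ℕ, (∀ d ∈ g, d ≤ t) →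
      (g.map fun d => t + 1 - d).sum + g.sum = g.card * (t + 1) := by
    intro g hg
    induction g using Multiset.induction_on with
    | empty => simp
    | cons d g ih =>
      have h1 := ih fun x hx => hg x (Multiset.mem_cons_of_mem hx)
      have h2 := hg d (Multiset.mem_cons_self d g)
      simp only [Multiset.map_cons, Multiset.sum_cons, Multiset.card_cons, add_mul, one_mul]
      omega
  have hsum' : (P.map (Multiset.map fun d => t + 1 - d)).sum =
      ∑ i ∈ Finset.range t, (m + 1).choose (i + 1) • {i + 1} := by
    have h1 : (P.map (Multiset.map fun d => t + 1 - d)).sum =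
        P.sum.map fun d => t + 1 - d :=
      (map_multiset_sum (Multiset.mapAddMonoidHom fun d => t + 1 - d) P).symm
    rw [h1, hsum]
    refine (map_sum (Multiset.mapAddMonoidHom fun d => t + 1 - d) _ _).trans ?_
    refine Finset.sum_congr rfl fun i hi => ?_
    have := Finset.mem_range.mp hi
    rw [map_nsmul]
    congr 1
    simp only [Multiset.coe_mapAddMonoidHom, Multiset.map_singleton]
    congr 1
    omega
  -- Here the fillers are the edges of size k; the bound `N = m + 1` on the number of edges carries
  -- no information.
  obtain ⟨P', -, h2, h3⟩ := Multiset.exists_filling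
    (P := P.map (Multiset.map fun d => t + 1 - d)) (x := t + 1) (σ := m + 1)
    (N := m + 1) (c := (m + 1).choose (t + 1)) (Nat.succ_pos t) (by
      intro g' hg'
      obtain ⟨g, hg, rfl⟩ := Multiset.mem_map.mp hg'
      obtain ⟨N, hN1, hN2⟩ := hP g hg
      have h := hrefl g (hmem g hg)
      obtain ⟨c, rfl⟩ := Nat.exists_eq_add_of_le hN2
      have h' : (g.map fun d => t + 1 - d).sum + c * (t + 1) = m + 1 := by
        rw [add_mul] at hN1
        omega
      refine ⟨c, h', ?_⟩
      have h4 : g.card ≤ (g.map fun d => t + 1 - d).sum := by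
        rw [← Multiset.card_map (fun d => t + 1 - d) g]
        simpa using Multiset.card_nsmul_le_sum (s := g.map fun d => t + 1 - d) (a := 1)
          (by
            intro x hx
            obtain ⟨d, hd, rfl⟩ := Multiset.mem_map.mp hx
            have := hmem g hg d hd
            omega)
      have h5 : c ≤ c * (t + 1) := Nat.le_mul_of_pos_right _ (Nat.succ_pos t)
      rw [Multiset.card_map]
      omega) (by
      rw [hsum', Multiset.card_map, hcard, ← sum_choose_succ_mul, Finset.sum_range_succ,
        Multiset.sum_finset_sum]
      simp [Multiset.sum_nsmul])
  refine exists_isFactorDistribution_of_sizes P' (fun g hg => (h3 g hg).1) ?_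
  rw [h2, hsum', Finset.sum_range_succ]

/-- The common scheme of the constructions: all but `P₀.card` of the factors have the same
multiset of deficits `β`, and the others are obtained by filling `P₀` with deficits `x`. -/
theorem exists_isFactorDistribution_of_bins {m t x σ N c F : ℕ} (P₀ : Multiset (Multiset ℕ))
    (β : Multiset ℕ) (hx : 0 < x)
    (hP : ∀ g ∈ P₀, ∃ c, g.sum + c * x = σ ∧ g.card + c ≤ N)
    (hσ : m + 1 + σ = N * (t + 1))
    (hβ : ∃ N, m + 1 + β.sum = N * (t + 1) ∧ β.card ≤ N)
    (hcard : F + P₀.card = chooseSum m (t + 1))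
    (hc : P₀.sum.sum + c * x = σ * P₀.card)
    (hsum : F • β + P₀.sum + c • {x} =
      ∑ i ∈ Finset.range t, (m + 1).choose (i + 1) • {t - i}) :
    ∃ (J : Type) (_ : Fintype J) (a : J → ℕ → ℕ), IsFactorDistribution (m + 1) (t + 1) a := by
  obtain ⟨P', h1, h2, h3⟩ := Multiset.exists_filling hx hP hc
  refine exists_isFactorDistribution_of_deficits (F • {β} + P') ?_ ?_ ?_
  · intro g hg
    rcases Multiset.mem_add.mp hg with hg | hg
    · rw [Multiset.mem_singleton.mp (Multiset.mem_of_mem_nsmul hg)]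
      exact hβ
    · obtain ⟨h4, h5⟩ := h3 g hg
      exact ⟨N, by rw [h4, hσ], h5⟩
  · simp [h1, hcard]
  · rw [Multiset.sum_add, Multiset.sum_nsmul, Multiset.sum_singleton, h2, ← hsum, add_assoc]

theorem sum_choose_succ_mul_deficit (m t : ℕ) :
    ∑ i ∈ Finset.range t, (m + 1).choose (i + 1) * (t - i) + (m + 1) * chooseSum m t + (t + 1) =
      (t + 1) * (2 * chooseSum m t + m.choose t) := by
  rw [← sum_choose_succ_mul, ← Finset.sum_add_distrib, ← sum_choose_succ_add_one, mul_add, mul_one,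
    Finset.mul_sum]
  congr 1
  refine Finset.sum_congr rfl fun i hi => ?_
  have := Finset.mem_range.mp hi
  rw [← mul_add, mul_comm]
  congr 1
  omega

/-- Consecutive coefficients up to C(m, t) grow by a factor of at least (p + s) / s, so the sum is
dominated by a geometric series. -/
theorem mul_chooseSum_le_mul_choose {m t p s : ℕ} (h : (p + 2 * s) * t ≤ s * (m + 1)) :
    p * chooseSum m t ≤ s * m.choose t := by
  induction t with
  | zero => simp [chooseSum_zero]
  | succ t ih =>
    have h1 := ih ((Nat.mul_le_mul_left _ (Nat.le_succ t)).trans h)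
    have h2 := Nat.choose_succ_right_eq m t
    have h3 : (p + s) * (t + 1) ≤ s * (m - t) := by
      have : m + 1 ≤ (m - t) + (t + 1) := by omega
      have := Nat.mul_le_mul_left s this
      linarith
    rw [chooseSum_succ, mul_add]
    refine Nat.le_of_mul_le_mul_right (c := t + 1) ?_ (Nat.succ_pos t)
    calc (p * chooseSum m t + p * m.choose t) * (t + 1)
        ≤ (s * m.choose t + p * m.choose t) * (t + 1) := Nat.mul_le_mul_right _ (by omega)
      _ = m.choose t * ((p + s) * (t + 1)) := by ring
      _ ≤ m.choose t * (s * (m - t)) := Nat.mul_le_mul_left _ h3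
      _ = s * m.choose (t + 1) * (t + 1) := by rw [mul_assoc, h2]; ring

theorem chooseSum_le_choose {m t : ℕ} (h : 3 * t ≤ m + 1) : chooseSum m t ≤ m.choose t := by
  simpa using mul_chooseSum_le_mul_choose (p := 1) (s := 1) (by simpa using h)

/-! ### Constructions for k dividing n -/

/-- The case `n = q k` with `k = l + 2 ≤ q + 1`. -/
theorem exists_isFactorDistribution_of_dvd_of_le {m l p : ℕ} (hn : m + 1 = (p + 1) * (l + 2))
    (hp : 2 ≤ p) (hl : l ≤ p) :
    ∃ (J : Type) (_ : Fintype J) (a : J → ℕ → ℕ), IsFactorDistribution (m + 1) (l + 2) a := by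
  have hgeom : (l + 1) * chooseSum m l ≤ m.choose l := by
    have h := mul_chooseSum_le_mul_choose (m := m) (t := l) (p := l + 1) (s := 1)
      (by rw [hn]; nlinarith)
    rwa [one_mul] at h
  have hstep : m.choose (l + 1) * (l + 1) = m.choose l * (p * (l + 2) + 1) := by
    rw [Nat.choose_succ_right_eq]
    congr 1
    have : (p + 1) * (l + 2) = p * (l + 2) + (l + 2) := by ring
    omega
  -- w is the number of bins seeded by no edge; the total deficit forces this value.
  obtain ⟨w, hw⟩ : ∃ w, m.choose (l + 1) = p * chooseSum m (l + 1) + chooseSum m l + w := by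
    refine Nat.exists_eq_add_of_le (Nat.le_of_mul_le_mul_right (c := l + 1) ?_ (Nat.succ_pos l))
    rw [hstep, chooseSum_succ]
    nlinarith
  have hD := sum_choose_succ_mul_deficit m (l + 1)
  rw [Finset.sum_range_succ, Nat.add_sub_cancel_left, mul_one] at hD
  have hY := sum_choose_succ_add_one m l
  have hg := chooseSum_succ m l
  have hF := chooseSum_succ m (l + 1)
  obtain ⟨F, hF'⟩ : ∃ F, chooseSum m (l + 1 + 1) =
      (∑ i ∈ Finset.range l, (m + 1).choose (i + 1) + w) + F := by
    refine Nat.exists_eq_add_of_le ?_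
    have : 2 * chooseSum m (l + 1) ≤ p * chooseSum m (l + 1) := Nat.mul_le_mul_right _ hp
    omega
  refine exists_isFactorDistribution_of_bins (x := 1) (σ := l + 2) (N := p + 2)
    (c := (m + 1).choose (l + 1)) (F := F)
    (∑ i ∈ Finset.range l, (m + 1).choose (i + 1) • {{l + 1 - i}} + w • {0}) 0 one_pos ?_ ?_ ?_
    ?_ ?_ ?_
  · intro g hg
    rcases Multiset.mem_add.mp hg with hg | hg
    · obtain ⟨i, hi, hg⟩ := Multiset.mem_sum.mp hg
      rw [Multiset.mem_singleton.mp (Multiset.mem_of_mem_nsmul hg)]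
      have := Finset.mem_range.mp hi
      refine ⟨i + 1, ?_, ?_⟩ <;> simp <;> omega
    -- A bin of k deficits 1 fits into p + 2 edges because l ≤ p.
    · rw [Multiset.mem_singleton.mp (Multiset.mem_of_mem_nsmul hg)]
      refine ⟨l + 2, ?_, ?_⟩ <;> simp; omega
  · rw [hn]; ring
  · exact ⟨p + 1, by simpa using hn, by simp⟩
  · simp [Multiset.card_sum, hF']
    omega
  · simp [Multiset.sum_add, Multiset.sum_finset_sum, Multiset.sum_nsmul, Multiset.card_sum]
    have h1 := congrArg (fun z => (l + 2) * z) hY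
    have h2 := congrArg (fun z => z * chooseSum m (l + 1)) hn
    rw [h2, hw, hg] at hD
    linarith
  · simp [Multiset.sum_add, Multiset.sum_finset_sum, Multiset.sum_nsmul, Finset.sum_range_succ]

/-- The case `n = k (k - 2)` with `k = l + 3`. -/
theorem exists_isFactorDistribution_of_eq_mul {m l : ℕ} (hn : m + 1 = (l + 1) * (l + 3))
    (hl : 2 ≤ l) :
    ∃ (J : Type) (_ : Fintype J) (a : J → ℕ → ℕ), IsFactorDistribution (m + 1) (l + 3) a := by
  have hstep : m.choose (l + 1) = (l + 2) * m.choose l := by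
    refine Nat.eq_of_mul_eq_mul_right (Nat.succ_pos l) ?_
    rw [Nat.succ_eq_add_one, Nat.choose_succ_right_eq, show m - l = (l + 1) * (l + 2) by
      have : (l + 1) * (l + 3) = (l + 1) * (l + 2) + (l + 1) := by ring
      omega]
    ring
  have hstep' : m.choose (l + 2) = (l ^ 2 + 3 * l + 1) * m.choose l := by
    refine Nat.eq_of_mul_eq_mul_right (Nat.succ_pos (l + 1)) ?_
    rw [Nat.succ_eq_add_one, Nat.choose_succ_right_eq m (l + 1), hstep,
      show m - (l + 1) = l ^ 2 + 3 * l + 1 by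
        have : (l + 1) * (l + 3) = (l ^ 2 + 3 * l + 1) + (l + 2) := by ring
        omega]
    ring
  have hgeom : 2 * chooseSum m l ≤ m.choose l := by
    have h := mul_chooseSum_le_mul_choose (m := m) (t := l) (p := 2) (s := 1)
      (by rw [hn]; nlinarith)
    rwa [one_mul] at h
  have hC2 : (m + 1).choose (l + 1) = (l + 3) * m.choose l := by
    rw [Nat.choose_succ_succ', hstep]; ring
  -- Now q + 1 = k - 1, so k deficits 1 no longer fit and every bin needs a deficit of at least 2.
  -- The number of pairs {2, 2} is chosen so that the bins have the right total deficit.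
  obtain ⟨v, hv⟩ : ∃ v, (m + 1).choose (l + 1) = 2 * ((l + 1) * chooseSum m l) + v := by
    refine Nat.exists_eq_add_of_le ?_
    rw [hC2]
    nlinarith
  have hD := sum_choose_succ_mul_deficit m (l + 2)
  rw [Finset.sum_range_succ, Finset.sum_range_succ, show l + 2 - l = 2 by omega,
    show l + 2 - (l + 1) = 1 by omega, mul_one] at hD
  have hY := sum_choose_succ_add_one m l
  have hg := chooseSum_succ m l
  have hg' := chooseSum_succ m (l + 1)
  have hF := chooseSum_succ m (l + 2)
  obtain ⟨F, hF'⟩ : ∃ F, chooseSum m (l + 2 + 1) =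
      (∑ i ∈ Finset.range l, (m + 1).choose (i + 1) + v + (l + 1) * chooseSum m l) + F := by
    refine Nat.exists_eq_add_of_le ?_
    nlinarith
  refine exists_isFactorDistribution_of_bins (x := 1) (σ := l + 3) (N := l + 2)
    (c := (m + 1).choose (l + 2)) (F := F)
    (∑ i ∈ Finset.range l, (m + 1).choose (i + 1) • {{l + 2 - i}} + v • {{2}} +
      ((l + 1) * chooseSum m l) • {{2, 2}}) 0 one_pos ?_ ?_ ?_ ?_ ?_ ?_
  · intro g hg
    rcases Multiset.mem_add.mp hg with hg | hg
    · rcases Multiset.mem_add.mp hg with hg | hg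
      · obtain ⟨i, hi, hg⟩ := Multiset.mem_sum.mp hg
        rw [Multiset.mem_singleton.mp (Multiset.mem_of_mem_nsmul hg)]
        have := Finset.mem_range.mp hi
        refine ⟨i + 1, ?_, ?_⟩ <;> simp <;> omega
      · rw [Multiset.mem_singleton.mp (Multiset.mem_of_mem_nsmul hg)]
        refine ⟨l + 1, ?_, ?_⟩ <;> simp <;> omega
    · rw [Multiset.mem_singleton.mp (Multiset.mem_of_mem_nsmul hg)]
      refine ⟨l - 1, ?_, ?_⟩ <;> simp <;> omega
  · rw [hn]; ring
  · exact ⟨l + 1, by simpa using hn, by simp⟩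
  · simp [Multiset.card_sum, hF']
    omega
  · simp [Multiset.sum_add, Multiset.sum_finset_sum, Multiset.sum_nsmul, Multiset.card_sum]
    have h1 := congrArg (fun z => (l + 3) * z) hY
    have h2 := congrArg (fun z => z * chooseSum m (l + 2)) hn
    have h3 := congrArg (fun z => (l + 3) * z) hv
    rw [h2, hg', hg, hstep', hstep] at hD
    rw [hC2] at h3 hD
    linarith
  · have h2 : ({2, 2} : Multiset ℕ) = 2 • {2} := rfl
    simp only [Finset.sum_range_succ, Multiset.sum_add, Multiset.sum_finset_sum,
      Multiset.sum_nsmul, Multiset.sum_singleton, hv, h2, smul_zero, zero_add, smul_smul, add_smul,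
      show l + 2 - l = 2 by omega, show l + 2 - (l + 1) = 1 by omega]
    rw [mul_comm 2]
    abel

/-! ### Constructions for k dividing n + 1 -/

/-- With `n = m + 1 = (p + 2) k - 1` and `k = h + 3`, the number of edges of size `k - 1` is at
least that of the factors consisting of one of them and of edges of size `k`. -/
theorem mul_chooseSum_lt_choose {m h p : ℕ} (hn : m + 2 = (p + 2) * (h + 3)) (hp : 1 ≤ p)
    (hh : h ≤ 2 * p + 3) : (p + 1) * chooseSum m (h + 1) < m.choose (h + 1) := by
  have hstep : m.choose (h + 1) * (h + 1) = m.choose h * ((p + 1) * (h + 3) + 1) := by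
    rw [Nat.choose_succ_right_eq]
    congr 1
    have : (p + 2) * (h + 3) = (p + 1) * (h + 3) + (h + 3) := by ring
    omega
  suffices hs : (h + 1) * (p + 1) * chooseSum m h + (h + 1) ≤ (2 * p + 3) * m.choose h by
    refine Nat.lt_of_succ_le (Nat.le_of_mul_le_mul_right (c := h + 1) ?_ (Nat.succ_pos h))
    rw [hstep, chooseSum_succ]
    nlinarith
  rcases Nat.eq_zero_or_pos h with rfl | hpos
  · simp [chooseSum_zero]
  have hgeom : (p * h + 3 * p + 5) * chooseSum m h ≤ h * m.choose h :=
    mul_chooseSum_le_mul_choose (by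
      refine le_of_eq ?_
      rw [mul_comm h]
      congr 1
      have : (p + 2) * (h + 3) = p * h + 3 * p + 5 + 2 * h + 1 := by ring
      omega)
  -- The slack d = 2p + 3 - h pays for the additive term h + 1 left over by the geometric estimate.
  obtain ⟨d, hd⟩ := Nat.exists_eq_add_of_le hh
  have hid : (2 * p + 3) * (p * h + 3 * p + 5) =
      h * (h + 1) * (p + 1) + h + d * ((p + 1) * h + (3 * p + 5)) := by
    have hp' : 2 * p + 3 = h + d := hd
    zify at hp' ⊢
    have : (d : ℤ) = 2 * p + 3 - h := by linarith
    rw [this]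
    ring
  have hbig : h * (h + 1) ≤ (h + d * ((p + 1) * h + (3 * p + 5))) * chooseSum m h := by
    obtain ⟨h, rfl⟩ : ∃ h', h = h' + 1 := ⟨h - 1, by omega⟩
    rcases Nat.eq_zero_or_pos h with rfl | hpos'
    · have : chooseSum m (0 + 1) = 1 := by simp [chooseSum]
      rw [this]
      have : 1 ≤ d := by omega
      nlinarith
    · have h1 : h + 1 + 1 ≤ chooseSum m (h + 1) := by
        obtain ⟨h, rfl⟩ : ∃ h', h = h' + 1 := ⟨h - 1, by omega⟩
        have : chooseSum m 2 ≤ chooseSum m (h + 1 + 1) :=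
          Finset.sum_le_sum_of_subset (Finset.range_subset_range.mpr (by omega))
        have h2 : chooseSum m 2 = m + 1 := by simp [chooseSum, Finset.sum_range_succ, add_comm]
        have h3 : m + 2 = p * (h + 5) + 2 * (h + 5) := by rw [hn]; ring
        omega
      exact Nat.mul_le_mul (Nat.le_add_right _ _) h1
  refine Nat.le_of_mul_le_mul_left (c := h) ?_ hpos
  calc h * ((h + 1) * (p + 1) * chooseSum m h + (h + 1))
      = h * (h + 1) * (p + 1) * chooseSum m h + h * (h + 1) := by ring
    _ ≤ h * (h + 1) * (p + 1) * chooseSum m h +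
        (h + d * ((p + 1) * h + (3 * p + 5))) * chooseSum m h := Nat.add_le_add_left hbig _
    _ = (2 * p + 3) * ((p * h + 3 * p + 5) * chooseSum m h) := by rw [← mul_assoc, hid]; ring
    _ ≤ (2 * p + 3) * (h * m.choose h) := Nat.mul_le_mul_left _ hgeom
    _ = h * ((2 * p + 3) * m.choose h) := by ring

/-- L is the number of deficits 1 left for the bins; the identity says that the bins' total deficit
is exactly k + 1 = h + 4 per bin. -/
theorem sum_deficits_of_dvd_succ {m h p L : ℕ} (hn : m + 2 = (p + 2) * (h + 3))
    (hL : m.choose (h + 1) = (p + 1) * chooseSum m (h + 1) + 1 + L) :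
    ∑ i ∈ Finset.range h, (m + 1).choose (i + 1) * (h + 2 - i) +
      (m + 1).choose (h + 1) * 2 + L = (h + 4) * (L + chooseSum m (h + 1)) := by
  have hstep : m.choose (h + 2) * (h + 2) = m.choose (h + 1) * ((p + 1) * (h + 3)) := by
    rw [Nat.choose_succ_right_eq m (h + 1)]
    congr 1
    have : (p + 2) * (h + 3) = (p + 1) * (h + 3) + (h + 3) := by ring
    omega
  have hD := sum_choose_succ_mul_deficit m (h + 2)
  have hC := Nat.choose_succ_succ' m (h + 1)
  rw [Finset.sum_range_succ, Finset.sum_range_succ, show h + 2 - h = 2 by omega,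
    show h + 2 - (h + 1) = 1 by omega, hC, chooseSum_succ m (h + 1)] at hD
  have h1 := congrArg (fun z => z * (chooseSum m (h + 1) + m.choose (h + 1))) hn
  have h2 := congrArg (fun z => z * (h + 3)) hL
  have h3 := congrArg (fun z => z * (p + 2) * (h + 3)) hL
  linarith

/-- Factors outside the bins have the single deficit 1. As the bins are filled with deficits 2, it
remains to distribute all other deficits so that each bin has the parity of k + 1 and at most p + 3
edges. -/
theorem exists_isFactorDistribution_of_dvd_succ_of_bins {m h p L : ℕ}
    (hn : m + 2 = (p + 2) * (h + 3))
    (hL : m.choose (h + 1) = (p + 1) * chooseSum m (h + 1) + 1 + L)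
    (P₀ : Multiset (Multiset ℕ))
    (hP : ∀ g ∈ P₀, ∃ c, g.sum + c * 2 = h + 4 ∧ g.card + c ≤ p + 3)
    (hcard : P₀.card = L + chooseSum m (h + 1))
    (hsum : P₀.sum =
      ∑ i ∈ Finset.range h, (m + 1).choose (i + 1) • {h + 2 - i} + L • {1}) :
    ∃ (J : Type) (_ : Fintype J) (a : J → ℕ → ℕ), IsFactorDistribution (m + 1) (h + 3) a := by
  have hS := sum_deficits_of_dvd_succ hn hL
  have hC : (m + 1).choose (h + 2) = m.choose (h + 1) + m.choose (h + 2) :=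
    Nat.choose_succ_succ' m (h + 1)
  obtain ⟨F, hF⟩ : ∃ F, (m + 1).choose (h + 2) = F + L :=
    ⟨(m + 1).choose (h + 2) - L, by rw [Nat.sub_add_cancel]; omega⟩
  refine exists_isFactorDistribution_of_bins (x := 2) (σ := h + 4) (N := p + 3)
    (c := (m + 1).choose (h + 1)) (F := F) P₀ {1} two_pos hP ?_ ⟨p + 2, ?_, ?_⟩ ?_ ?_ ?_
  · linarith
  · rw [← hn]; simp
  · simp
  · have h1 : chooseSum m (h + 3) = chooseSum m (h + 2) + m.choose (h + 2) := chooseSum_succ _ _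
    have h2 : chooseSum m (h + 2) = chooseSum m (h + 1) + m.choose (h + 1) := chooseSum_succ _ _
    rw [h1, h2, hcard]
    omega
  · rw [hsum, hcard, ← hS]
    simp [Multiset.sum_add, Multiset.sum_finset_sum, Multiset.sum_nsmul]
    omega
  · rw [Finset.sum_range_succ, Finset.sum_range_succ, show h + 2 - h = 2 by omega,
      show h + 2 - (h + 1) = 1 by omega, hF, hsum, add_smul]
    abel

theorem Finset.sum_range_two_mul {M : Type*} [AddCommMonoid M] (f : ℕ → M) (e : ℕ) :
    ∑ i ∈ Finset.range (2 * e), f i = ∑ j ∈ Finset.range e, (f (2 * j) + f (2 * j + 1)) := by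
  induction e with
  | zero => simp
  | succ e ih =>
    rw [Finset.sum_range_succ _ e, ← ih, show 2 * (e + 1) = 2 * e + 1 + 1 by ring,
      Finset.sum_range_succ, Finset.sum_range_succ, add_assoc]

theorem sum_choose_odd (m e : ℕ) :
    ∑ j ∈ Finset.range e, (m + 1).choose (2 * j + 1) = chooseSum m (2 * e) := by
  rw [chooseSum, Finset.sum_range_two_mul]
  exact Finset.sum_congr rfl fun j _ => Nat.choose_succ_succ' m (2 * j)

theorem sum_choose_even_add_one (m e : ℕ) :
    ∑ j ∈ Finset.range e, (m + 1).choose (2 * j + 2) + 1 = chooseSum m (2 * e + 1) := by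
  induction e with
  | zero => simp [chooseSum]
  | succ e ih =>
    rw [Finset.sum_range_succ, add_right_comm, ih, show 2 * (e + 1) = 2 * e + 1 + 1 by ring,
      chooseSum_succ m (2 * e + 1 + 1), chooseSum_succ m (2 * e + 1), Nat.choose_succ_succ']
    ring

/-- The construction for `n = (p + 2) k - 1` and `k = 2 e + 4`. Each bin has one odd deficit. The
`u j + v j` edges of even deficit `2 e + 2 - 2 j ≥ 4` are put together with `u j` deficits `1` and
`v j` deficits `3`. -/
theorem exists_isFactorDistribution_of_even {m e p L x y : ℕ} {u v : ℕ → ℕ}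
    (hn : m + 2 = (p + 2) * (2 * e + 4))
    (hL : m.choose (2 * e + 2) = (p + 1) * chooseSum m (2 * e + 2) + 1 + L)
    (huv : ∀ j < e, (m + 1).choose (2 * j + 2) = u j + v j)
    (hx : (m + 1).choose (2 * e + 1) = ∑ j ∈ Finset.range e, v j + x)
    (hy : L = ∑ j ∈ Finset.range e, u j + y) (he : e ≤ p + 1) (hyp : y = 0 ∨ e ≤ p) :
    ∃ (J : Type) (_ : Fintype J) (a : J → ℕ → ℕ),
      IsFactorDistribution (m + 1) (2 * e + 4) a := by
  refine exists_isFactorDistribution_of_dvd_succ_of_bins (h := 2 * e + 1) hn hL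
    (∑ j ∈ Finset.range e, ((m + 1).choose (2 * j + 1) • {{2 * e + 3 - 2 * j}} +
      u j • {{2 * e + 2 - 2 * j} + {1}} + v j • {{2 * e + 2 - 2 * j} + {3}}) +
      x • {{3}} + y • {{1}}) ?_ ?_ ?_
  · intro g hg
    simp only [Multiset.mem_add, Multiset.mem_sum, Finset.mem_range] at hg
    rcases hg with (⟨j, hj, (hg | hg) | hg⟩ | hg) | hg
    · rw [Multiset.mem_singleton.mp (Multiset.mem_of_mem_nsmul hg)]
      refine ⟨j + 1, ?_, ?_⟩ <;> simp <;> omega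
    · rw [Multiset.mem_singleton.mp (Multiset.mem_of_mem_nsmul hg)]
      refine ⟨j + 1, ?_, ?_⟩ <;> simp <;> omega
    · rw [Multiset.mem_singleton.mp (Multiset.mem_of_mem_nsmul hg)]
      refine ⟨j, ?_, ?_⟩ <;> simp <;> omega
    · rw [Multiset.mem_singleton.mp (Multiset.mem_of_mem_nsmul hg)]
      refine ⟨e + 1, ?_, ?_⟩ <;> simp <;> omega
    -- A lone deficit 1 needs e + 2 fillers, which fit only for e ≤ p.
    · rcases hyp with rfl | hyp
      · simp at hg
      · rw [Multiset.mem_singleton.mp (Multiset.mem_of_mem_nsmul hg)]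
        refine ⟨e + 2, ?_, ?_⟩ <;> simp <;> omega
  · have h1 := sum_choose_odd m e
    have h2 : chooseSum m (2 * e + 2) = chooseSum m (2 * e) + m.choose (2 * e) +
      m.choose (2 * e + 1) := by rw [chooseSum_succ, chooseSum_succ]
    have h3 := Nat.choose_succ_succ' m (2 * e)
    simp only [Multiset.card_add, Multiset.card_sum, Multiset.card_nsmul, Multiset.card_singleton,
      Finset.sum_add_distrib, mul_one]
    rw [show 2 * e + 1 + 1 = 2 * e + 2 by ring, h2]
    omega
  · rw [Finset.sum_range_succ, Finset.sum_range_two_mul]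
    simp only [Multiset.sum_add, Multiset.sum_finset_sum, Multiset.sum_nsmul,
      Multiset.sum_singleton, show 2 * e + 1 + 2 - 2 * e = 3 by omega, hx, hy, add_smul,
      Finset.sum_smul, Finset.sum_add_distrib, smul_add]
    have h1 : ∀ j ∈ Finset.range e, ((m + 1).choose (2 * j + 1 + 1) • {2 * e + 1 + 2 - (2 * j + 1)} :
        Multiset ℕ) = u j • {2 * e + 2 - 2 * j} + v j • {2 * e + 2 - 2 * j} := by
      intro j hj
      have := Finset.mem_range.mp hj
      rw [huv j this, add_smul, show 2 * e + 1 + 2 - (2 * j + 1) = 2 * e + 2 - 2 * j by omega]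
    rw [Finset.sum_congr rfl h1, Finset.sum_add_distrib]
    abel

/-- The construction for `n = (p + 2) k - 1` and `k = 2 f + 5`. The odd deficits are paired, where
the deficits greater than `3` are paired with deficits `3`. -/
theorem exists_isFactorDistribution_of_odd {m f p L x y z w : ℕ}
    (hn : m + 2 = (p + 2) * (2 * f + 5))
    (hL : m.choose (2 * f + 3) = (p + 1) * chooseSum m (2 * f + 3) + 1 + L)
    (hc : (m + 1).choose (2 * f + 2) =
      ∑ j ∈ Finset.range f, (m + 1).choose (2 * j + 2) + x + 2 * z)
    (hxy : L = x + 2 * y)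
    (hw : x + y + z + ∑ j ∈ Finset.range f, (m + 1).choose (2 * j + 2) + 1 =
      chooseSum m (2 * f + 2) + w) (hf : f ≤ p) (hyp : y = 0 ∨ f + 1 ≤ p) :
    ∃ (J : Type) (_ : Fintype J) (a : J → ℕ → ℕ),
      IsFactorDistribution (m + 1) (2 * f + 5) a := by
  refine exists_isFactorDistribution_of_dvd_succ_of_bins (h := 2 * f + 2) hn hL
    (∑ j ∈ Finset.range (f + 1), (m + 1).choose (2 * j + 1) • {{2 * f + 4 - 2 * j}} +
      ∑ j ∈ Finset.range f, (m + 1).choose (2 * j + 2) • {{2 * f + 3 - 2 * j} + {3}} +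
      x • {{1} + {3}} + y • {{1} + {1}} + z • {{3} + {3}} + w • {0}) ?_ ?_ ?_
  · intro g hg
    simp only [Multiset.mem_add, Multiset.mem_sum, Finset.mem_range] at hg
    rcases hg with ((((⟨j, hj, hg⟩ | ⟨j, hj, hg⟩) | hg) | hg) | hg) | hg
    · rw [Multiset.mem_singleton.mp (Multiset.mem_of_mem_nsmul hg)]
      refine ⟨j + 1, ?_, ?_⟩ <;> simp <;> omega
    · rw [Multiset.mem_singleton.mp (Multiset.mem_of_mem_nsmul hg)]
      refine ⟨j, ?_, ?_⟩ <;> simp <;> omega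
    · rw [Multiset.mem_singleton.mp (Multiset.mem_of_mem_nsmul hg)]
      refine ⟨f + 1, ?_, ?_⟩ <;> simp <;> omega
    -- The pair {1, 1} needs f + 2 fillers, which fit only for f + 1 ≤ p.
    · rcases hyp with rfl | hyp
      · simp at hg
      · rw [Multiset.mem_singleton.mp (Multiset.mem_of_mem_nsmul hg)]
        refine ⟨f + 2, ?_, ?_⟩ <;> simp <;> omega
    · rw [Multiset.mem_singleton.mp (Multiset.mem_of_mem_nsmul hg)]
      refine ⟨f, ?_, ?_⟩ <;> simp <;> omega
    · rw [Multiset.mem_singleton.mp (Multiset.mem_of_mem_nsmul hg)]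
      refine ⟨f + 3, ?_, ?_⟩ <;> simp <;> omega
  · have h1 := sum_choose_odd m (f + 1)
    have h2 := sum_choose_even_add_one m f
    have h3 : chooseSum m (2 * f + 3) = chooseSum m (2 * f + 1) + m.choose (2 * f + 1) +
      m.choose (2 * f + 2) := by rw [chooseSum_succ, chooseSum_succ]
    have h4 : (m + 1).choose (2 * f + 2) = m.choose (2 * f + 1) + m.choose (2 * f + 2) :=
      Nat.choose_succ_succ' m (2 * f + 1)
    rw [show 2 * (f + 1) = 2 * f + 2 by ring] at h1
    simp only [Multiset.card_add, Multiset.card_sum, Multiset.card_nsmul, Multiset.card_singleton,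
      mul_one, h1]
    rw [show 2 * f + 2 + 1 = 2 * f + 3 by ring, h3]
    omega
  · rw [Finset.sum_range_succ _ f, Finset.sum_range_succ _ (2 * f + 1),
      Finset.sum_range_succ _ (2 * f), Finset.sum_range_two_mul]
    have h1 : ∀ j ∈ Finset.range f, ((m + 1).choose (2 * j + 1) • {2 * f + 2 + 2 - 2 * j} +
        (m + 1).choose (2 * j + 1 + 1) • {2 * f + 2 + 2 - (2 * j + 1)} : Multiset ℕ) =
        (m + 1).choose (2 * j + 1) • {2 * f + 4 - 2 * j} +
        (m + 1).choose (2 * j + 2) • {2 * f + 3 - 2 * j} := by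
      intro j hj
      have := Finset.mem_range.mp hj
      rw [show 2 * f + 2 + 2 - (2 * j + 1) = 2 * f + 3 - 2 * j by omega]
    rw [Finset.sum_congr rfl h1, show 2 * f + 1 + 1 = 2 * f + 2 by ring, hc, hxy,
      show 2 * f + 2 + 2 - 2 * f = 4 by omega,
      show 2 * f + 2 + 2 - (2 * f + 1) = 3 by omega]
    simp only [Multiset.sum_add, Multiset.sum_finset_sum, Multiset.sum_nsmul,
      Multiset.sum_singleton, add_smul, two_mul, Finset.sum_smul, Finset.sum_add_distrib, smul_add, smul_zero]
    abel

/-! ### Small k, tight cases and assembly -/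

theorem exists_isFactorDistribution_one (m : ℕ) :
    ∃ (J : Type) (_ : Fintype J) (a : J → ℕ → ℕ), IsFactorDistribution (m + 1) 1 a :=
  exists_isFactorDistribution_of_deficits (t := 0) {0} (by simp) (by simp [chooseSum]) (by simp)

theorem exists_isFactorDistribution_of_dvd {m q k : ℕ} (hn : m + 1 = q * k) (hq : 3 ≤ q)
    (hk : 0 < k) (hkq : k ≤ q + 2) :
    ∃ (J : Type) (_ : Fintype J) (a : J → ℕ → ℕ), IsFactorDistribution (m + 1) k a := by
  rcases Nat.eq_or_lt_of_le hk with rfl | hk2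
  · exact exists_isFactorDistribution_one m
  rcases hkq.eq_or_lt with rfl | hlt
  · obtain ⟨l, rfl⟩ : ∃ l, q = l + 1 := ⟨q - 1, by omega⟩
    exact exists_isFactorDistribution_of_eq_mul hn (by omega)
  · obtain ⟨p, rfl⟩ : ∃ p, q = p + 1 := ⟨q - 1, by omega⟩
    obtain ⟨l, rfl⟩ : ∃ l, k = l + 2 := ⟨k - 2, by omega⟩
    exact exists_isFactorDistribution_of_dvd_of_le hn (by omega) (by omega)

/-- n is odd, and each of the n factors consists of one singleton and a matching of the other
vertices. -/
theorem exists_isFactorDistribution_two {m q : ℕ} (hn : m + 2 = q * 2) (hq : 0 < q) :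
    ∃ (J : Type) (_ : Fintype J) (a : J → ℕ → ℕ), IsFactorDistribution (m + 1) 2 a := by
  refine exists_isFactorDistribution_of_deficits (t := 1) ((m + 1) • {{1}}) ?_ ?_ ?_
  · intro g hg
    rw [Multiset.mem_singleton.mp (Multiset.mem_of_mem_nsmul hg)]
    exact ⟨q, by simpa using hn, by simpa using Nat.succ_le_of_lt hq⟩
  · simp [chooseSum, Finset.sum_range_succ, add_comm]
  · simp [Multiset.sum_nsmul]

/-- With `k = 2 e + 4 = 2 (p + 2) + 2`, the deficits `1` that remain do not outnumber the
deficits `4`. -/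
theorem le_choose_of_tight_even {m f L : ℕ} (hn : m + 2 = (f + 2) * (2 * f + 6))
    (hL : m.choose (2 * f + 4) = (f + 1) * chooseSum m (2 * f + 4) + 1 + L) :
    L ≤ m.choose (2 * f + 2) := by
  have h1 : m.choose (2 * f + 4) * (2 * f + 4) =
      m.choose (2 * f + 3) * (2 * f ^ 2 + 8 * f + 7) := by
    rw [Nat.choose_succ_right_eq m (2 * f + 3)]
    congr 1
    have : (f + 2) * (2 * f + 6) = 2 * f ^ 2 + 8 * f + 7 + 2 + (2 * f + 3) := by ring
    omega
  have h2 : m.choose (2 * f + 3) * (2 * f + 3) = m.choose (2 * f + 2) * (2 * (f + 2) ^ 2) := by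
    rw [Nat.choose_succ_right_eq m (2 * f + 2)]
    congr 1
    have : (f + 2) * (2 * f + 6) = 2 * (f + 2) ^ 2 + 2 + (2 * f + 2) := by ring
    omega
  have h3 : m.choose (2 * f + 2) + m.choose (2 * f + 3) ≤ chooseSum m (2 * f + 4) := by
    rw [chooseSum_succ, chooseSum_succ]
    omega
  generalize m.choose (2 * f + 4) = b₂ at *
  generalize m.choose (2 * f + 3) = b₁ at *
  generalize m.choose (2 * f + 2) = b₀ at *
  have h4 := Nat.mul_le_mul_left ((f + 1) * (2 * f + 4)) h3
  have h5 := congrArg (fun z => z * (2 * f + 4)) hL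
  refine Nat.le_of_mul_le_mul_right (c := 2 * f + 4) ?_ (by omega)
  nlinarith

/-- With `k = 2 f + 5 = 2 (p + 2) + 1`, the deficits `1` that remain do not outnumber the
deficits `3`. -/
theorem le_choose_of_tight_odd {m f L : ℕ} (hn : m + 2 = (f + 2) * (2 * f + 5))
    (hL : m.choose (2 * f + 3) = (f + 1) * chooseSum m (2 * f + 3) + 1 + L) :
    L ≤ m.choose (2 * f + 2) := by
  have h1 : m.choose (2 * f + 3) = (f + 2) * m.choose (2 * f + 2) := by
    refine Nat.eq_of_mul_eq_mul_right (Nat.succ_pos (2 * f + 2)) ?_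
    rw [Nat.succ_eq_add_one, Nat.choose_succ_right_eq m (2 * f + 2), show
      m - (2 * f + 2) = (f + 2) * (2 * f + 3) by
        have : (f + 2) * (2 * f + 5) = (f + 2) * (2 * f + 3) + 2 + (2 * f + 2) := by ring
        omega]
    ring
  have h2 : m.choose (2 * f + 2) ≤ chooseSum m (2 * f + 3) := by
    rw [chooseSum_succ]
    omega
  have h3 := Nat.mul_le_mul_left (f + 1) h2
  rw [h1] at hL
  linarith

theorem three_mul_le_of_dvd_succ {m h p : ℕ} (hn : m + 2 = (p + 2) * (h + 3)) (hp : 1 ≤ p) :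
    3 * h + 7 ≤ m := by
  have := Nat.mul_le_mul_right (h + 3) (show 3 ≤ p + 2 by omega)
  omega

theorem exists_isFactorDistribution_of_dvd_succ_of_even {m p e : ℕ}
    (hn : m + 2 = (p + 2) * (2 * e + 4)) (hp : 1 ≤ p) (he : e ≤ p + 1) :
    ∃ (J : Type) (_ : Fintype J) (a : J → ℕ → ℕ),
      IsFactorDistribution (m + 1) (2 * e + 4) a := by
  have hm := three_mul_le_of_dvd_succ (h := 2 * e + 1) hn hp
  obtain ⟨L, hL⟩ := Nat.exists_eq_add_of_le
    (Nat.succ_le_of_lt (mul_chooseSum_lt_choose (h := 2 * e + 1) hn hp (by omega)))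
  have hE := sum_choose_even_add_one m e
  have hg : chooseSum m (2 * e + 1) ≤ m.choose (2 * e + 1) := chooseSum_le_choose (by omega)
  have hc := Nat.choose_succ_succ' m (2 * e)
  rcases he.eq_or_lt with rfl | hlt
  -- For e = p + 1 no bin may hold a lone 1, so all L of them join deficits 4, the class j = p.
  · have hL4 := le_choose_of_tight_even hn hL
    have hc4 : (m + 1).choose (2 * p + 2) = m.choose (2 * p + 1) + m.choose (2 * p + 2) :=
      Nat.choose_succ_succ' m (2 * p + 1)
    rw [Finset.sum_range_succ] at hE
    refine exists_isFactorDistribution_of_even (e := p + 1) (y := 0)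
      (u := fun j => if j = p then L else 0)
      (v := fun j => (m + 1).choose (2 * j + 2) - if j = p then L else 0)
      (x := (m + 1).choose (2 * (p + 1) + 1) - ∑ j ∈ Finset.range (p + 1),
        ((m + 1).choose (2 * j + 2) - if j = p then L else 0))
      hn hL (fun j _ => ?_) ?_ ?_ le_rfl (Or.inl rfl)
    · by_cases hj : j = p
      · subst hj; simp; omega
      · simp [hj]
    · refine (Nat.add_sub_cancel' ?_).symm
      refine (Finset.sum_le_sum fun j _ => Nat.sub_le _ _).trans ?_
      rw [Finset.sum_range_succ]
      omega
    · simp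
  · refine exists_isFactorDistribution_of_even (y := L) (u := fun _ => 0)
      (v := fun j => (m + 1).choose (2 * j + 2))
      (x := (m + 1).choose (2 * e + 1) - ∑ j ∈ Finset.range e, (m + 1).choose (2 * j + 2))
      hn hL (fun _ _ => by simp) ?_ (by simp) (by omega) (Or.inr (by omega))
    omega

theorem exists_isFactorDistribution_of_dvd_succ_of_odd {m p f : ℕ}
    (hn : m + 2 = (p + 2) * (2 * f + 5)) (hp : 1 ≤ p) (hf : f ≤ p) :
    ∃ (J : Type) (_ : Fintype J) (a : J → ℕ → ℕ),
      IsFactorDistribution (m + 1) (2 * f + 5) a := by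
  have hm := three_mul_le_of_dvd_succ (h := 2 * f + 2) hn hp
  obtain ⟨L, hL⟩ := Nat.exists_eq_add_of_le
    (Nat.succ_le_of_lt (mul_chooseSum_lt_choose (h := 2 * f + 2) hn hp (by omega)))
  have hS := sum_deficits_of_dvd_succ (h := 2 * f + 2) hn hL
  have hZ := sum_choose_even_add_one m f
  have hg1 : chooseSum m (2 * f + 1) ≤ m.choose (2 * f + 1) := chooseSum_le_choose (by omega)
  have hg2 : chooseSum m (2 * f + 2) ≤ m.choose (2 * f + 2) := chooseSum_le_choose (by omega)
  have hg : chooseSum m (2 * f + 2) = chooseSum m (2 * f + 1) + m.choose (2 * f + 1) :=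
    chooseSum_succ _ _
  have hc : (m + 1).choose (2 * f + 2) = m.choose (2 * f + 1) + m.choose (2 * f + 2) :=
    Nat.choose_succ_succ' m (2 * f + 1)
  set Z := ∑ j ∈ Finset.range f, (m + 1).choose (2 * j + 2) with hZdef
  -- The number of odd deficits in the bins (1, 3 and the Z larger ones) is even, because their
  -- total deficit is a multiple of the even number k + 1.
  have hpar : (L + (m + 1).choose (2 * f + 2) + Z) % 2 = 0 := by
    have h1 : 2 ∣ ∑ i ∈ Finset.range (2 * f + 2), (m + 1).choose (i + 1) * (2 * f + 2 + 2 - i) +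
        (m + 1).choose (2 * f + 2) + Z := by
      rw [Finset.sum_range_succ, Finset.sum_range_succ, Finset.sum_range_two_mul, hZdef]
      have h2 : ∀ j ∈ Finset.range f, 2 ∣ (m + 1).choose (2 * j + 1) * (2 * f + 2 + 2 - 2 * j) +
          (m + 1).choose (2 * j + 1 + 1) * (2 * f + 2 + 2 - (2 * j + 1)) +
          (m + 1).choose (2 * j + 2) := by
        intro j hj
        have := Finset.mem_range.mp hj
        refine ⟨(m + 1).choose (2 * j + 1) * (f + 2 - j) +
          (m + 1).choose (2 * j + 2) * (f + 2 - j), ?_⟩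
        rw [show 2 * f + 2 + 2 - 2 * j = 2 * (f + 2 - j) by omega,
          show 2 * f + 2 + 2 - (2 * j + 1) = 2 * (f + 2 - j) - 1 by omega]
        obtain ⟨d, hd⟩ : ∃ d, f + 2 - j = d + 1 := ⟨f + 1 - j, by omega⟩
        rw [hd, show 2 * (d + 1) - 1 = 2 * d + 1 by omega]
        ring
      have h3 := Finset.dvd_sum h2
      rw [Finset.sum_add_distrib] at h3
      rw [show 2 * f + 2 + 2 - 2 * f = 4 by omega, show 2 * f + 2 + 2 - (2 * f + 1) = 3 by omega]
      rw [show 2 * f + 1 + 1 = 2 * f + 2 by ring]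
      omega
    have h2 : 2 ∣ (2 * f + 2 + 4) * (L + chooseSum m (2 * f + 2 + 1)) :=
      Dvd.dvd.mul_right ⟨f + 3, by ring⟩ _
    omega
  -- If enough deficits 3 remain after serving the Z larger odd ones, every 1 is paired with a 3;
  -- otherwise pairs {1, 1} are needed, and the tight case f = p is excluded.
  by_cases hLc : L + Z ≤ (m + 1).choose (2 * f + 2)
  · exact exists_isFactorDistribution_of_odd (x := L) (y := 0)
      (z := ((m + 1).choose (2 * f + 2) - Z - L) / 2)
      (w := L + ((m + 1).choose (2 * f + 2) - Z - L) / 2 + Z + 1 - chooseSum m (2 * f + 2))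
      hn hL (by omega) rfl (by omega) hf (Or.inl rfl)
  · have hfp : f + 1 ≤ p := by
      by_contra hne
      obtain rfl : f = p := by omega
      have := le_choose_of_tight_odd hn hL
      omega
    exact exists_isFactorDistribution_of_odd (x := (m + 1).choose (2 * f + 2) - Z)
      (y := (L + Z - (m + 1).choose (2 * f + 2)) / 2) (z := 0)
      (w := (m + 1).choose (2 * f + 2) - Z + (L + Z - (m + 1).choose (2 * f + 2)) / 2 + Z + 1 -
        chooseSum m (2 * f + 2))
      hn hL (by omega) (by omega) (by omega) hf (Or.inr hfp)

theorem exists_isFactorDistribution_three {m p : ℕ} (hn : m + 2 = (p + 2) * 3) (hp : 1 ≤ p) :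
    ∃ (J : Type) (_ : Fintype J) (a : J → ℕ → ℕ), IsFactorDistribution (m + 1) 3 a := by
  obtain ⟨L, hL⟩ := Nat.exists_eq_add_of_le
    (Nat.succ_le_of_lt (mul_chooseSum_lt_choose (h := 0) hn hp (by omega)))
  have hS := sum_deficits_of_dvd_succ (h := 0) hn hL
  have hg : chooseSum m (0 + 1) = 1 := by simp [chooseSum]
  simp only [Finset.range_zero, Finset.sum_empty, hg] at hS
  -- `hS` makes L even: the deficits 1 go in pairs, and the other bins hold only deficits 2.
  refine exists_isFactorDistribution_of_dvd_succ_of_bins (h := 0) hn hL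
    ((L / 2) • {{1} + {1}} + (L - L / 2 + 1) • {0}) ?_ ?_ ?_
  · intro g hg
    rcases Multiset.mem_add.mp hg with hg | hg
    · rw [Multiset.mem_singleton.mp (Multiset.mem_of_mem_nsmul hg)]
      refine ⟨1, ?_, ?_⟩ <;> simp
    · rw [Multiset.mem_singleton.mp (Multiset.mem_of_mem_nsmul hg)]
      refine ⟨2, ?_, ?_⟩ <;> simp
  · simp [hg]
    omega
  · have h1 : L = L / 2 + L / 2 := by omega
    simp only [Multiset.sum_add, Multiset.sum_nsmul, Multiset.sum_singleton, smul_zero, smul_add,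
      add_zero, Finset.range_zero, Finset.sum_empty, zero_add]
    rw [← add_smul, ← h1]

theorem exists_isFactorDistribution_of_dvd_succ {m q k : ℕ} (hn : m + 2 = q * k) (hq : 3 ≤ q)
    (hk : 0 < k) (hkq : k ≤ 2 * q + 2) :
    ∃ (J : Type) (_ : Fintype J) (a : J → ℕ → ℕ), IsFactorDistribution (m + 1) k a := by
  obtain ⟨p, rfl⟩ : ∃ p, q = p + 2 := ⟨q - 2, by omega⟩
  rcases Nat.even_or_odd' k with ⟨e, rfl | rfl⟩
  · rcases Nat.lt_or_ge e 2 with h | h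
    · obtain rfl : e = 1 := by omega
      exact exists_isFactorDistribution_two hn (by omega)
    · obtain ⟨e, rfl⟩ := Nat.exists_eq_add_of_le' h
      exact exists_isFactorDistribution_of_dvd_succ_of_even hn (by omega) (by omega)
  · rcases Nat.lt_or_ge e 2 with h | h
    · obtain rfl | rfl : e = 0 ∨ e = 1 := by omega
      · exact exists_isFactorDistribution_one m
      · exact exists_isFactorDistribution_three hn (by omega)
    · obtain ⟨f, rfl⟩ := Nat.exists_eq_add_of_le' h
      exact exists_isFactorDistribution_of_dvd_succ_of_odd hn (by omega) (by omega)

theorem mainTheorem1 (n k : ℕ) (hn : 0 < n) (hk : 0 < k) (hkn : (k : ℚ) < (n : ℚ) / 2) :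
    IsHypergraphFactorable 1 (completeHypergraphLE n k) ↔
      ((n : ℤ) ≡ 0 [ZMOD (k : ℤ)] ∧ (n : ℤ) ≥ (k : ℤ) * ((k : ℤ) - 2)) ∨
      ((n : ℤ) ≡ -1 [ZMOD (k : ℤ)] ∧ (n : ℤ) ≥ (k : ℤ) * (⌈(k : ℚ) / 2⌉ - 1) - 1) := by
  have h2k : 2 * k < n := by
    have : (2 * k : ℚ) < n := by linarith
    exact_mod_cast this
  have hkpos : (0 : ℤ) < k := by exact_mod_cast hk
  have hceil : ∀ q : ℤ, ⌈(k : ℚ) / 2⌉ - 1 ≤ q ↔ (k : ℤ) ≤ 2 * q + 2 := by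
    intro q
    rw [sub_le_iff_le_add, Int.ceil_le, div_le_iff₀ two_pos]
    push_cast
    constructor
    · intro h
      have : (k : ℚ) ≤ ((2 * q + 2 : ℤ) : ℚ) := by push_cast; linarith
      exact_mod_cast this
    · intro h
      have : (k : ℚ) ≤ ((2 * q + 2 : ℤ) : ℚ) := by exact_mod_cast h
      push_cast at this
      linarith
  obtain ⟨m, rfl⟩ : ∃ m, n = m + 1 := ⟨n - 1, by omega⟩
  constructor
  · intro h
    obtain ⟨J, _, a, ha⟩ := exists_isFactorDistribution h
    rcases ha.dvd_or_dvd_succ hk h2k with ⟨q, hq, hkq⟩ | ⟨q, hq, hkq⟩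
    · left
      zify at hq hkq
      refine ⟨Int.modEq_zero_iff_dvd.mpr ⟨q, by push_cast; rw [hq, mul_comm]⟩, ?_⟩
      push_cast
      rw [hq, mul_comm (q : ℤ)]
      exact mul_le_mul_of_nonneg_left (by linarith) hkpos.le
    · right
      zify at hq hkq
      refine ⟨(Int.modEq_iff_dvd.mpr ⟨-q, by push_cast; linarith⟩), ?_⟩
      have := mul_le_mul_of_nonneg_left ((hceil q).mpr hkq) hkpos.le
      push_cast
      linarith
  · rintro (⟨h1, h2⟩ | ⟨h1, h2⟩)
    · obtain ⟨q, hq⟩ := Int.modEq_zero_iff_dvd.mp h1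
      have hkq : (k : ℤ) - 2 ≤ q := le_of_mul_le_mul_left (hq ▸ h2) hkpos
      have hq3 : 2 < q := by
        refine lt_of_mul_lt_mul_left (a := (k : ℤ)) ?_ hkpos.le
        rw [← hq]
        exact_mod_cast (by omega : k * 2 < m + 1)
      lift q to ℕ using by omega
      obtain ⟨J, _, a, ha⟩ := exists_isFactorDistribution_of_dvd (m := m) (q := q) (k := k)
        (by rw [mul_comm]; exact_mod_cast hq) (by omega) hk (by omega)
      exact ha.isHypergraphFactorable
    · obtain ⟨q, hq⟩ := Int.modEq_iff_dvd.mp h1.symm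
      have hq' : (m : ℤ) + 2 = k * q := by push_cast at hq; linarith
      have hkq : (k : ℤ) ≤ 2 * q + 2 := by
        rw [← hceil]
        refine le_of_mul_le_mul_left (a := (k : ℤ)) ?_ hkpos
        rw [← hq']
        push_cast at h2
        linarith
      have hq3 : 2 < q := by
        refine lt_of_mul_lt_mul_left (a := (k : ℤ)) ?_ hkpos.le
        rw [← hq']
        exact_mod_cast (by omega : k * 2 < m + 2)
      lift q to ℕ using by omega
      obtain ⟨J, _, a, ha⟩ := exists_isFactorDistribution_of_dvd_succ (m := m) (q := q) (k := k)
        (by rw [mul_comm]; exact_mod_cast hq') (by omega) hk (by omega)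
      exact ha.isHypergraphFactorable
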